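/- **Setting.** Let $(V,\omega)$ be a locally convex symplectic space: $V$ is a real Hausdorff locally convex space and $\omega\colon V\times V\to\mathbb R$ is a continuous, alternating, non-degenerate bilinear form ($\omega(v,\cdot)=0$ implies $v=0$). Let $\gamma\colon\mathbb R\to \mathrm{Sp}(V,\omega)$ be a one-parameter group of continuous $\omega$-preserving linear automorphisms such that the map $\mathbb R\times V\to V$, $(t,v)\mapsto\gamma(t)v$, is smooth (smoothness between locally convex spaces means that all iterated directional derivatives exist and are jointly continuous). Put $D:=\gamma'(0)\colon V\to V$. The generalized oscillator group $G=G(V,\omega,\gamma)$ is $\mathbb R\times V\times\mathbb R$ with $$(z,v,t)(z',v',t')=\big(z+z'+\tfrac12\omega(v,\gamma(t)v'),\,v+\gamma(t)v',\,t+t'\big);$$ its Lie algebra is $\mathfrak g=\mathbb R\times V\times\mathbb R$ as a topological vector space. For $\lambda$ in the topological dual $\mathfrak g'$ the coadjoint orbit is $\mathcal O_\lambda=\{\lambda\circ \mathrm{Ad}(g)^{-1}: g\in G\}$; it is non-trivial if $\mathcal O_\lambda\ne\{\lambda\}$. It is semi-equicontinuous if $x\mapsto \sup_{\alpha\in\mathcal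 O_\lambda}\alpha(-x)$ is bounded on a neighborhood of some point of $\mathfrak g$. For a unitary representation $\pi\colon G\to \mathrm U(\mathcal H)$ on a complex Hilbert space, $\mathcal H^\infty$ denotes the space of vectors $v$ with smooth orbit map $g\mapsto\pi(g)v$, and for $x\in\mathfrak g$ the operator $d\pi(x)$ with domain $\mathcal H^\infty$ sends $v$ to the derivative of this orbit map at $\mathbf 1$ in the direction $x$. The representation is smooth if $\mathcal H^\infty$ is dense. It is semibounded if the operators $i\,d\pi(x)$ are uniformly bounded from above for $x$ in a neighborhood $U$ of some point of $\mathfrak g$, i.e. if there is $C\in\mathbb R$ such that for all $x\in U$ one has $\langle i\,d\pi(x)v,v\rangle\le C\|v\|^2$ for all $v\in\mathcal H^\infty$ and, whenever $x$ generates a one-parameter subgroup $\exp(\mathbb Rx)$ of $G$ (so that the closure of $i\,d\pi(x)$ is selfadjoint), $\sup\mathrm{Spec}(i\,d\pi(x))\le C$, where $\mathrm{Spec}$ refers to the closure. **Lemma.** Let $G=G(V,\omega,\gamma)$ be a generalized oscillator group that has a non-trivial semi-equicontinuous coadjoint orbit, and suppose that $D=\gamma'(0)$ has dense range in $V$. Let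 $\pi\colon G\to \mathrm U(\mathcal H)$ be a smooth unitary representation with $\pi(t,0,0)=e^{it}\mathbf 1$ for all $t\in\mathbb R$ and such that $-i\,d\pi(0,0,1)$ is bounded from below. Then $\pi$ is semibounded. -/

import Mathlib

open Topology Filter
open scoped InnerProductSpace

universe u v

noncomputable section

/-! ### Smooth maps between locally convex spaces -/

section Calculus

variable {E F : Type*} [AddCommGroup E] [Module ℝ E] [TopologicalSpace E]
  [AddCommGroup F] [Module ℝ F] [TopologicalSpace F]

/-- The curve `f : ℝ → F` has derivative `f'` at the parameter `0`. -/
def HasVelocity (f : ℝ → F) (f' : F) : Prop :=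
  Tendsto (fun s : ℝ => s⁻¹ • (f s - f 0)) (𝓝[≠] 0) (𝓝 f')

/-- `f` is smooth in the sense of calculus in locally convex spaces (Michal--Bastiani): all
iterated directional derivatives `d k x (h₀, …, h_{k-1})` exist, and each of them is continuous
as a function of `(x, h₀, …, h_{k-1})`. -/
def IsSmoothMap (f : E → F) : Prop :=
  ∃ d : (k : ℕ) → E → (Fin k → E) → F,
    (∀ x h, d 0 x h = f x) ∧
    (∀ k, Continuous fun p : E × (Fin k → E) => d k p.1 p.2) ∧
    ∀ (k : ℕ) (x : E) (h : Fin k → E) (y : E),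
      HasVelocity (fun s : ℝ => d k (x + s • y) h)
        (d (k + 1) x (Fin.snoc (α := fun _ => E) h y))

theorem HasVelocity.unique [T2Space F] {f : ℝ → F} {a b : F}
    (ha : HasVelocity f a) (hb : HasVelocity f b) : a = b :=
  tendsto_nhds_unique ha hb

theorem HasVelocity.add [IsTopologicalAddGroup F] {f g : ℝ → F} {a b : F}
    (ha : HasVelocity f a) (hb : HasVelocity g b) :
    HasVelocity (fun s => f s + g s) (a + b) := by
  refine (Tendsto.add ha hb).congr fun s => ?_
  rw [← smul_add, add_sub_add_comm]

theorem HasVelocity.map {F' : Type*} [AddCommGroup F'] [Module ℝ F'] [TopologicalSpace F']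
    {f : ℝ → F} {a : F} (L : F →L[ℝ] F') (ha : HasVelocity f a) :
    HasVelocity (fun s => L (f s)) (L a) := by
  refine ((L.continuous.tendsto a).comp ha).congr fun s => ?_
  simp

theorem HasVelocity.rescale {f : ℝ → F} {a : F} [ContinuousConstSMul ℝ F] (r : ℝ)
    (ha : HasVelocity f a) : HasVelocity (fun s => f (s * r)) (r • a) := by
  by_cases hr : r = 0
  · subst hr
    simp [HasVelocity, tendsto_const_nhds]
  · have h1 : Tendsto (fun s : ℝ => s * r) (𝓝[≠] 0) (𝓝[≠] 0) := by
      refine tendsto_nhdsWithin_iff.mpr ⟨?_, ?_⟩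
      · have : Tendsto (fun s : ℝ => s * r) (𝓝 0) (𝓝 (0 * r)) := tendsto_id.mul_const r
        rw [zero_mul] at this
        exact this.mono_left nhdsWithin_le_nhds
      · filter_upwards [self_mem_nhdsWithin] with s hs
        exact mul_ne_zero hs hr
    refine ((ha.comp h1).const_smul r).congr fun s => ?_
    simp only [Function.comp_apply, smul_smul, zero_mul, mul_inv_rev]
    rw [← mul_assoc, mul_inv_cancel₀ hr, one_mul]

theorem HasVelocity.const (c : F) : HasVelocity (fun _ => c) 0 := by
  simp [HasVelocity, tendsto_const_nhds]

end Calculus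

/-! ### Generalized oscillator groups -/

/-- The data `(V, ω, γ)` of a generalized oscillator group: a locally convex symplectic space
`(V, ω)` and a representation `γ` of `ℝ` by symplectic maps defining a smooth action on `V`. -/
structure OscillatorData (V : Type u) [AddCommGroup V] [Module ℝ V] [TopologicalSpace V] where
  ω : V →ₗ[ℝ] V →ₗ[ℝ] ℝ
  ω_continuous : Continuous fun p : V × V => ω p.1 p.2
  ω_alternating : ∀ v, ω v v = 0
  ω_nondegenerate : ∀ v, (∀ w, ω v w = 0) → v = 0
  γ : ℝ → V →L[ℝ] V
  γ_zero : γ 0 = ContinuousLinearMap.id ℝ V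
  γ_add : ∀ s t, γ (s + t) = (γ s).comp (γ t)
  γ_symplectic : ∀ t v w, ω (γ t v) (γ t w) = ω v w
  γ_smooth : IsSmoothMap fun p : ℝ × V => γ p.1 p.2

namespace OscillatorData

variable {V : Type u} [AddCommGroup V] [Module ℝ V] [TopologicalSpace V] (S : OscillatorData V)

theorem γ_zero_apply (v : V) : S.γ 0 v = v := by simp [S.γ_zero]

theorem γ_add_apply (s t : ℝ) (v : V) : S.γ (s + t) v = S.γ s (S.γ t v) := by
  simp [S.γ_add]

theorem γ_neg_apply (t : ℝ) (v : V) : S.γ t (S.γ (-t) v) = v := by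
  rw [← S.γ_add_apply, add_neg_cancel, S.γ_zero_apply]

theorem γ_neg_apply' (t : ℝ) (v : V) : S.γ (-t) (S.γ t v) = v := by
  rw [← S.γ_add_apply, neg_add_cancel, S.γ_zero_apply]

theorem ω_swap (v w : V) : S.ω v w = -S.ω w v := by
  have h := S.ω_alternating (v + w)
  simp only [map_add, LinearMap.add_apply, S.ω_alternating] at h
  linarith

theorem continuous_γ_apply [IsTopologicalAddGroup V] [ContinuousSMul ℝ V] (v : V) :
    Continuous fun s : ℝ => S.γ s v := by
  obtain ⟨d, h0, hc, -⟩ := S.γ_smooth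
  have h := (hc 0).comp ((continuous_id.prodMk (continuous_const (y := v))).prodMk
    (continuous_const (y := (Fin.elim0 : Fin 0 → ℝ × V))))
  refine h.congr fun s => ?_
  simp [h0]

theorem exists_generator [IsTopologicalAddGroup V] [ContinuousSMul ℝ V] [T2Space V] :
    ∃ D : V →L[ℝ] V, ∀ v, HasVelocity (fun s : ℝ => S.γ s v) (D v) := by
  obtain ⟨d, h0, hc, hd⟩ := S.γ_smooth
  let y : ℝ × V := (1, 0)
  let h1 : Fin 1 → ℝ × V := Fin.snoc (α := fun _ => ℝ × V) Fin.elim0 y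
  have key : ∀ v, HasVelocity (fun s : ℝ => S.γ s v) (d 1 (0, v) h1) := by
    intro v
    have := hd 0 (0, v) Fin.elim0 y
    simpa [h0, y] using this
  refine ⟨{ toFun := fun v => d 1 (0, v) h1
            map_add' := fun v w => ?_
            map_smul' := fun c v => ?_
            cont := ?_ }, key⟩
  · refine (key (v + w)).unique ?_
    simpa using (key v).add (key w)
  · refine (key (c • v)).unique ?_
    have := (key v).map (c • ContinuousLinearMap.id ℝ V)
    simpa using this
  · exact (hc 1).comp
      ((continuous_const.prodMk continuous_id).prodMk (continuous_const (y := h1)))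

/-- The infinitesimal generator `D = γ'(0)`, a continuous linear operator on `V`. -/
def D [IsTopologicalAddGroup V] [ContinuousSMul ℝ V] [T2Space V] : V →L[ℝ] V :=
  S.exists_generator.choose

theorem D_spec [IsTopologicalAddGroup V] [ContinuousSMul ℝ V] [T2Space V] (v : V) :
    HasVelocity (fun s : ℝ => S.γ s v) (S.D v) :=
  S.exists_generator.choose_spec v

end OscillatorData

/-- The underlying set `ℝ × V × ℝ` of the generalized oscillator group
`G(V, ω, γ) = Heis(V, ω) ⋊_γ ℝ`. -/
@[ext]
structure OscillatorGroup {V : Type u} [AddCommGroup V] [Module ℝ V] [TopologicalSpace V]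
    (S : OscillatorData V) where
  z : ℝ
  v : V
  t : ℝ

namespace OscillatorGroup

variable {V : Type u} [AddCommGroup V] [Module ℝ V] [TopologicalSpace V] {S : OscillatorData V}

/-- `(z, v, t) (z', v', t') = (z + z' + ½ ω(v, γ(t) v'), v + γ(t) v', t + t')`. -/
instance : Mul (OscillatorGroup S) :=
  ⟨fun a b => ⟨a.z + b.z + 1 / 2 * S.ω a.v (S.γ a.t b.v), a.v + S.γ a.t b.v, a.t + b.t⟩⟩

instance : One (OscillatorGroup S) := ⟨⟨0, 0, 0⟩⟩

instance : Inv (OscillatorGroup S) := ⟨fun a => ⟨-a.z, -S.γ (-a.t) a.v, -a.t⟩⟩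

theorem mul_def (a b : OscillatorGroup S) : a * b =
    ⟨a.z + b.z + 1 / 2 * S.ω a.v (S.γ a.t b.v), a.v + S.γ a.t b.v, a.t + b.t⟩ := rfl

theorem one_def : (1 : OscillatorGroup S) = ⟨0, 0, 0⟩ := rfl

theorem inv_def (a : OscillatorGroup S) : a⁻¹ = ⟨-a.z, -S.γ (-a.t) a.v, -a.t⟩ := rfl

instance : Group (OscillatorGroup S) :=
  Group.ofLeftAxioms
    (by
      intro a b c
      simp only [mul_def, map_add, LinearMap.add_apply, S.γ_add_apply, S.γ_symplectic]
      ext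
      · simp only; ring
      · simp only [add_assoc]
      · simp only; ring)
    (by
      intro a
      ext <;> simp [mul_def, one_def, S.γ_zero_apply])
    (by
      intro a
      ext <;> simp [mul_def, one_def, inv_def, S.ω_alternating])

/-- The global chart of `G(V, ω, γ)`, whose model space `ℝ × V × ℝ` is also the underlying
topological vector space of the Lie algebra `𝔤 = T₁ G`. -/
def ofVec (S : OscillatorData V) (x : ℝ × V × ℝ) : OscillatorGroup S := ⟨x.1, x.2.1, x.2.2⟩

/-- The inverse of the global chart. -/
def toVec (g : OscillatorGroup S) : ℝ × V × ℝ := (g.z, g.v, g.t)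

section Adjoint

variable [IsTopologicalAddGroup V] [ContinuousSMul ℝ V] [T2Space V]

/-- The adjoint action of `G(V, ω, γ)` on its Lie algebra; it is the derivative of the conjugation
action at `1`, see `hasVelocity_conj`. -/
def Ad (g : OscillatorGroup S) : (ℝ × V × ℝ) →L[ℝ] (ℝ × V × ℝ) where
  toFun x := (x.1 + S.ω g.v (S.γ g.t x.2.1) + 1 / 2 * x.2.2 * S.ω (S.D g.v) g.v,
    S.γ g.t x.2.1 - x.2.2 • S.D g.v, x.2.2)
  map_add' x y := by
    ext
    · simp; ring
    · simp [add_smul]; abel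
    · simp
  map_smul' c x := by
    ext
    · simp; ring
    · simp [smul_sub, mul_smul]
    · simp
  cont := by
    have h1 : Continuous fun x : ℝ × V × ℝ => S.ω g.v (S.γ g.t x.2.1) :=
      S.ω_continuous.comp (continuous_const.prodMk
        ((S.γ g.t).continuous.comp (continuous_fst.comp continuous_snd)))
    have h2 : Continuous fun x : ℝ × V × ℝ => S.γ g.t x.2.1 :=
      (S.γ g.t).continuous.comp (continuous_fst.comp continuous_snd)
    have h3 : Continuous fun x : ℝ × V × ℝ => x.2.2 := continuous_snd.comp continuous_snd
    exact ((continuous_fst.add h1).add ((continuous_const.mul h3).mul continuous_const)).prodMk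
      ((h2.sub (h3.smul continuous_const)).prodMk h3)

theorem hasVelocity_conj (g : OscillatorGroup S) (x : ℝ × V × ℝ) :
    HasVelocity (fun s : ℝ => toVec (g * ofVec S (s • x) * g⁻¹)) (Ad g x) := by
  obtain ⟨x₁, x₂, x₃⟩ := x
  have hq : HasVelocity (fun s : ℝ => S.γ (s * x₃) g.v) (x₃ • S.D g.v) :=
    (S.D_spec g.v).rescale x₃
  have hγ : Tendsto (fun s : ℝ => S.γ (s * x₃) g.v) (𝓝[≠] 0) (𝓝 g.v) := by
    have h := ((S.continuous_γ_apply g.v).comp (continuous_mul_const x₃)).tendsto 0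
    simp only [Function.comp_apply, zero_mul, S.γ_zero_apply] at h
    exact h.mono_left nhdsWithin_le_nhds
  have h1 := ((S.ω_continuous.comp (continuous_const.prodMk continuous_id)).tendsto _).comp
    (f := fun s : ℝ => s⁻¹ • (S.γ (s * x₃) g.v - S.γ (0 * x₃) g.v))
    (g := fun w => S.ω g.v w) hq
  have h2 := ((S.ω_continuous.comp (continuous_const.prodMk continuous_id)).tendsto _).comp
    (g := fun w => S.ω (S.γ g.t x₂) w) hγ
  have h3 := (((tendsto_const_nhds (x := x₁ + 1 / 2 * S.ω g.v (S.γ g.t x₂))).sub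
    (h1.const_mul (1 / 2))).sub (h2.const_mul (1 / 2))).prodMk_nhds
    (((tendsto_const_nhds (x := S.γ g.t x₂)).sub hq).prodMk_nhds
      (tendsto_const_nhds (x := x₃)))
  have hval : (Ad g (x₁, x₂, x₃)) =
      (x₁ + 1 / 2 * S.ω g.v (S.γ g.t x₂) - 1 / 2 * S.ω g.v (x₃ • S.D g.v)
        - 1 / 2 * S.ω (S.γ g.t x₂) g.v, S.γ g.t x₂ - x₃ • S.D g.v, x₃) := by
    simp only [Ad, ContinuousLinearMap.coe_mk', LinearMap.coe_mk, AddHom.coe_mk, map_smul,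
      smul_eq_mul]
    rw [S.ω_swap (S.γ g.t x₂) g.v, S.ω_swap (S.D g.v) g.v]
    ext
    · simp only; ring
    · rfl
    · rfl
  rw [hval]
  refine h3.congr' ?_
  filter_upwards [self_mem_nhdsWithin] with s hs
  have hs : s ≠ 0 := hs
  have e1 : S.γ (g.t + s * x₃) (S.γ (-g.t) g.v) = S.γ (s * x₃) g.v := by
    rw [add_comm, S.γ_add_apply, S.γ_neg_apply]
  simp only [toVec, ofVec, mul_def, inv_def, Function.comp_apply, Prod.smul_mk, smul_eq_mul,
    map_neg, e1, zero_mul, mul_zero, zero_smul, add_zero, S.γ_zero_apply, S.γ_neg_apply, map_smul,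
    map_add, map_sub, LinearMap.add_apply, LinearMap.smul_apply, S.ω_alternating, map_zero,
    Prod.mk_sub_mk, Prod.fst_zero, Prod.snd_zero]
  ext
  · simp only
    field_simp
    ring
  · simp only
    rw [show g.v + s • S.γ g.t x₂ + -S.γ (s * x₃) g.v - (g.v + -g.v)
      = s • S.γ g.t x₂ - (S.γ (s * x₃) g.v - g.v) by abel,
      smul_sub _ (s • _), smul_smul,
      inv_mul_cancel₀ hs, one_smul]
  · simp only
    field_simp
    ring

end Adjoint

end OscillatorGroup

/-! ### Semi-equicontinuous sets and coadjoint orbits -/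

/-- The support functional `s_E(x) = sup ⟨E, -x⟩`, with values in `[-∞, ∞]`. -/
def supportFunctional {W : Type*} [AddCommGroup W] [Module ℝ W] [TopologicalSpace W]
    (E : Set (W →L[ℝ] ℝ)) (x : W) : EReal :=
  ⨆ α ∈ E, ((α (-x) : ℝ) : EReal)

/-- `E` is semi-equicontinuous if its support functional is bounded (from above) on a
neighborhood of some point. A lower bound near the point is automatic for `E ≠ ∅`. -/
def IsSemiEquicontinuous {W : Type*} [AddCommGroup W] [Module ℝ W] [TopologicalSpace W]
    (E : Set (W →L[ℝ] ℝ)) : Prop :=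
  ∃ x₀ : W, ∃ U ∈ 𝓝 x₀, ∃ C : ℝ, ∀ x ∈ U, supportFunctional E x ≤ (C : EReal)

section Coadjoint

variable {V : Type u} [AddCommGroup V] [Module ℝ V] [TopologicalSpace V]
  [IsTopologicalAddGroup V] [ContinuousSMul ℝ V] [T2Space V]

/-- The coadjoint orbit of `l ∈ 𝔤'`, that is, the set of all `Ad*(g) l = l ∘ Ad(g)⁻¹`. -/
def coadjointOrbit (S : OscillatorData V) (l : (ℝ × V × ℝ) →L[ℝ] ℝ) :
    Set ((ℝ × V × ℝ) →L[ℝ] ℝ) :=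
  Set.range fun g : OscillatorGroup S => l.comp (OscillatorGroup.Ad g⁻¹)

end Coadjoint

/-! ### Unbounded operators -/

section Unbounded

variable {H : Type v} [NormedAddCommGroup H] [InnerProductSpace ℂ H]

/-- `μ` lies in the resolvent set of the unbounded operator `A`: the operator `A - μ` is a
bijection from the domain of `A` onto `H` with bounded inverse `R`. -/
def IsResolventPoint (A : H →ₗ.[ℂ] H) (μ : ℂ) : Prop :=
  ∃ R : H →L[ℂ] H,
    (∀ y : H, ∃ hy : R y ∈ A.domain, A ⟨R y, hy⟩ - μ • R y = y) ∧
    ∀ x : A.domain, R (A x - μ • (x : H)) = x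

/-- The supremum in `[-∞, ∞]` of the real spectrum of the closure of `A`. (It is applied to
operators whose closure is selfadjoint, so that all the spectrum is real.) -/
def supSpec (A : H →ₗ.[ℂ] H) : EReal :=
  ⨆ r ∈ {r : ℝ | ¬ IsResolventPoint A.closure (r : ℂ)}, (r : EReal)

/-- `⟨A v, v⟩ ≤ C ‖v‖²` on the domain of `A`. -/
def IsBoundedAboveBy (A : H →ₗ.[ℂ] H) (C : ℝ) : Prop :=
  ∀ v : A.domain, (⟪(v : H), A v⟫_ℂ).re ≤ C * ‖(v : H)‖ ^ 2

/-- `c ‖v‖² ≤ ⟨A v, v⟩` on the domain of `A`, for some real `c`. -/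
def IsBoundedBelow (A : H →ₗ.[ℂ] H) : Prop :=
  ∃ c : ℝ, ∀ v : A.domain, c * ‖(v : H)‖ ^ 2 ≤ (⟪(v : H), A v⟫_ℂ).re

end Unbounded

/-! ### Unitary representations -/

section Representations

variable {V : Type u} [AddCommGroup V] [Module ℝ V] [TopologicalSpace V]
  {S : OscillatorData V}
  {H : Type v} [NormedAddCommGroup H] [InnerProductSpace ℂ H] [CompleteSpace H]

/-- The orbit map `g ↦ π(g) ξ`, in the global chart. -/
def orbitMap (π : OscillatorGroup S →* unitary (H →L[ℂ] H)) (ξ : H) (x : ℝ × V × ℝ) : H :=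
  (π (OscillatorGroup.ofVec S x) : H →L[ℂ] H) ξ

/-- The space `H^∞` of smooth vectors: those with smooth orbit map. -/
def smoothVectors (π : OscillatorGroup S →* unitary (H →L[ℂ] H)) : Submodule ℂ H where
  carrier := {ξ | IsSmoothMap (orbitMap π ξ)}
  zero_mem' := by
    refine ⟨fun _ _ _ => 0, ?_, fun _ => continuous_const, fun _ _ _ _ => HasVelocity.const 0⟩
    intro x h
    simp [orbitMap]
  add_mem' := by
    rintro ξ η ⟨d, h0, hc, hd⟩ ⟨e, k0, kc, kd⟩
    refine ⟨fun k x h => d k x h + e k x h, ?_, fun k => (hc k).add (kc k),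
      fun k x h y => (hd k x h y).add (kd k x h y)⟩
    intro x h
    simp [h0, k0, orbitMap]
  smul_mem' := by
    rintro c ξ ⟨d, h0, hc, hd⟩
    refine ⟨fun k x h => c • d k x h, ?_, fun k => (hc k).const_smul c, fun k x h y => ?_⟩
    · intro x h
      simp [h0, orbitMap]
    · exact (hd k x h y).map ((c • ContinuousLinearMap.id ℂ H).restrictScalars ℝ)

/-- A unitary representation is smooth if its smooth vectors are dense. -/
def IsSmoothRep (π : OscillatorGroup S →* unitary (H →L[ℂ] H)) : Prop :=
  Dense (smoothVectors π : Set H)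

theorem differentiableAt_orbitMap (π : OscillatorGroup S →* unitary (H →L[ℂ] H))
    (x : ℝ × V × ℝ) {ξ : H} (hξ : ξ ∈ smoothVectors π) :
    DifferentiableAt ℝ (fun s : ℝ => orbitMap π ξ (s • x)) 0 := by
  obtain ⟨d, h0, hc, hd⟩ := hξ
  have h := hd 0 0 Fin.elim0 x
  simp only [h0, zero_add] at h
  refine HasDerivAt.differentiableAt
    (f' := d (0 + 1) 0 (Fin.snoc (α := fun _ => ℝ × V × ℝ) Fin.elim0 x))
    (hasDerivAt_iff_tendsto_slope_zero.mpr ?_)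
  simpa [HasVelocity] using h

/-- The derived representation `dπ(x)` for `x ∈ 𝔤`, as an operator with domain `H^∞`: the value
`dπ(x) ξ` is the derivative of the orbit map of `ξ` at `1` in the direction of `x`. -/
def derivedRep (π : OscillatorGroup S →* unitary (H →L[ℂ] H)) (x : ℝ × V × ℝ) : H →ₗ.[ℂ] H where
  domain := smoothVectors π
  toFun :=
    { toFun := fun ξ => deriv (fun s : ℝ => orbitMap π (ξ : H) (s • x)) 0
      map_add' := fun ξ η => by
        rw [← deriv_fun_add (differentiableAt_orbitMap π x ξ.2) (differentiableAt_orbitMap π x η.2)]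
        congr 1
        funext s
        simp [orbitMap]
      map_smul' := fun c ξ => by
        simp only [RingHom.id_apply]
        rw [← deriv_fun_const_smul c (differentiableAt_orbitMap π x ξ.2)]
        congr 1
        funext s
        simp [orbitMap] }

/-- `x ∈ 𝔤` generates a one-parameter subgroup of `G(V, ω, γ)`, that is, `exp(ℝ x)` exists. -/
def GeneratesOneParam (S : OscillatorData V) (x : ℝ × V × ℝ) : Prop :=
  ∃ c : ℝ → OscillatorGroup S, (∀ s t, c (s + t) = c s * c t) ∧
    HasVelocity (fun s : ℝ => (c s).toVec) x

/-- `π` is semibounded: on a neighborhood of some point of `𝔤` the operators `i dπ(x)` are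
uniformly bounded from above. For the numerical range this makes sense for every `x`. Whenever the
one-parameter subgroup `exp(ℝ x)` exists, the closure of `i dπ(x)` is the selfadjoint generator of
`π(exp(ℝ x))`, and its spectrum `Spec(i dπ(x))` has to be bounded by the same constant; if `V` is
not complete, `𝔤` may contain `x` without such a subgroup. -/
def IsSemibounded (π : OscillatorGroup S →* unitary (H →L[ℂ] H)) : Prop :=
  ∃ x₀ : ℝ × V × ℝ, ∃ U ∈ 𝓝 x₀, ∃ C : ℝ, ∀ x ∈ U,
    IsBoundedAboveBy (Complex.I • derivedRep π x) C ∧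
    (GeneratesOneParam S x → supSpec (Complex.I • derivedRep π x) ≤ (C : EReal))

end Representations

end

/-! For a smooth vector `ξ`, let `φ(x) = Re ⟨ξ, -i dπ(x) ξ⟩`, a continuous linear functional on the
Lie algebra with `φ(1,0,0) = ‖ξ‖²`. Smooth vectors are invariant under `π` and `φ ∘ Ad g` is the
functional of `π(g)⁻¹ξ`, so the bound `φ(0,0,1) ≥ c‖ξ‖²` may be transported along `Ad (0,su,0)`.
With `B = φ(0,0,1) - c‖ξ‖²` this gives `0 ≤ (s²/2) ω(Du,u) ‖ξ‖² - s φ(0,Du,0) + B` for all real `s`.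
Hence `ω(Du,u) ≥ 0` as soon as a nonzero smooth vector exists, and the discriminant yields
`φ(0,Du,0)² ≤ 2 ω(Du,u) ‖ξ‖² B` (`quadratic_nonneg_of_lower_bound`).

The same scaling argument on the semi-equicontinuous orbit bounds `ω(Du,u)` by a constant `M`
whenever `Du` lies in a suitable 0-neighborhood `W` (`exists_hamiltonian_bound`). Since `D` has
dense range, `φ(0,v,0)² ≤ 2M‖ξ‖²B` for all `v` in the interior of `W`, so `|φ(0,v,0)| ≤ B/2 +
M‖ξ‖²`. For `t > 1/2` the term `tB` absorbs `B/2`, which bounds `-φ` by a multiple of `‖ξ‖²`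
uniformly near `(0,0,1)`.

The spectral bound is deduced from the numerical one. If `x` generates a one-parameter group,
invariance of the smooth vectors makes the range of `i dπ(x) - μ` dense for `Im μ > 0`
(`shiftedRange_derivedRep_orthogonal`); a closable operator bounded above by `C` with this property
has no real spectrum beyond `C` (`IsBoundedAboveBy.supSpec_le`). -/

set_option linter.unusedSectionVars false

/-! ### Directional derivatives, the chain rule and iterated total differentials -/

section Calculus

section Velocity

variable {E : Type*} [AddCommGroup E] [Module ℝ E] [TopologicalSpace E]
  {F : Type*} [AddCommGroup F] [Module ℝ F] [TopologicalSpace F]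
  {G : Type*} [NormedAddCommGroup G] [NormedSpace ℝ G]

theorem hasVelocity_iff_hasDerivAt {f : ℝ → G} {a : G} :
    HasVelocity f a ↔ HasDerivAt f a 0 := by
  simp [HasVelocity, hasDerivAt_iff_tendsto_slope_zero]

/-- A velocity of `f` along all lines in direction `y` is a derivative at every parameter. -/
theorem hasDerivAt_line {f : E → G} {y : E} {δ : E → G}
    (h : ∀ q, HasVelocity (fun s : ℝ => f (q + s • y)) (δ q)) (x : E) (s : ℝ) :
    HasDerivAt (fun s : ℝ => f (x + s • y)) (δ (x + s • y)) s := by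
  have h1 := hasVelocity_iff_hasDerivAt.mp (h (x + s • y))
  have h1' : HasDerivAt (fun r : ℝ => f (x + s • y + r • y)) (δ (x + s • y)) (s - s) := by
    simpa using h1
  refine (h1'.comp_sub_const s s).congr_of_eventuallyEq (Eventually.of_forall fun r => ?_)
  simp only [sub_smul]
  congr 1
  abel

/-- Mean value estimate along a line segment. -/
theorem norm_line_sub_le {f : E → G} {y : E} {δ : E → G}
    (h : ∀ q, HasVelocity (fun s : ℝ => f (q + s • y)) (δ q)) (x : E) (s : ℝ) (a : G) {ε : ℝ}
    (hε : ∀ r : ℝ, |r| ≤ |s| → ‖δ (x + r • y) - a‖ ≤ ε) :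
    ‖f (x + s • y) - f x - s • a‖ ≤ ε * |s| := by
  have h1 : ∀ r : ℝ, HasDerivAt (fun s : ℝ => f (x + s • y) - s • a)
      (δ (x + r • y) - a) r := fun r => by
    simpa using (hasDerivAt_line h x r).fun_sub ((hasDerivAt_id' r).smul_const a)
  have h2 := (convex_uIcc (0 : ℝ) s).norm_image_sub_le_of_norm_hasDerivWithin_le
    (f := fun s : ℝ => f (x + s • y) - s • a) (f' := fun r => δ (x + r • y) - a) (C := ε)
    (fun r _ => (h1 r).hasDerivWithinAt)
    (fun r hr => hε r (by simpa using Set.abs_sub_left_of_mem_uIcc hr))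
    Set.left_mem_uIcc Set.right_mem_uIcc
  simpa [sub_right_comm] using h2

theorem HasVelocity.of_eventually_norm_le {f : ℝ → G} {a : G}
    (h : ∀ ε > 0, ∀ᶠ s in 𝓝[≠] (0 : ℝ), ‖f s - f 0 - s • a‖ ≤ ε * |s|) :
    HasVelocity f a := by
  rw [HasVelocity, Metric.tendsto_nhds]
  intro ε hε
  filter_upwards [h (ε / 2) (half_pos hε), self_mem_nhdsWithin] with s hs hs0
  have hs0 : s ≠ 0 := hs0
  have : s⁻¹ • (f s - f 0) - a = s⁻¹ • (f s - f 0 - s • a) := by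
    rw [smul_sub _ _ (s • a), smul_smul, inv_mul_cancel₀ hs0, one_smul]
  rw [dist_eq_norm, this, norm_smul, norm_inv, Real.norm_eq_abs]
  have hp : 0 < |s| := abs_pos.mpr hs0
  calc |s|⁻¹ * ‖f s - f 0 - s • a‖ ≤ |s|⁻¹ * (ε / 2 * |s|) := by gcongr
    _ = ε / 2 := by field_simp
    _ < ε := half_lt_self hε

/-- The increment is split as a step along `b` followed by a step along `a`; the mean value estimate
and continuity of `δ` control the second. Only direction `a` needs a continuous derivative, so
directions can be adjoined one at a time. -/
theorem HasVelocity.along_add [IsTopologicalAddGroup E] [ContinuousSMul ℝ E]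
    {f : E → G} {a b p : E} {δ : E → G} {β : G} (hδ : Continuous δ)
    (ha : ∀ q, HasVelocity (fun s : ℝ => f (q + s • a)) (δ q))
    (hb : HasVelocity (fun s : ℝ => f (p + s • b)) β) :
    HasVelocity (fun s : ℝ => f (p + s • (a + b))) (δ p + β) := by
  have key : HasVelocity (fun s : ℝ => f (p + s • b + s • a) - f (p + s • b)) (δ p) := by
    refine HasVelocity.of_eventually_norm_le fun ε hε => ?_
    have hc : Continuous fun r : ℝ × ℝ => δ (p + r.1 • b + r.2 • a) := by fun_prop
    have h0 : Tendsto (fun r : ℝ × ℝ => δ (p + r.1 • b + r.2 • a)) (𝓝 0) (𝓝 (δ p)) := by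
      simpa using hc.tendsto 0
    obtain ⟨η, hη, hη'⟩ := Metric.eventually_nhds_iff.mp
      (h0.eventually (Metric.closedBall_mem_nhds (δ p) hε))
    filter_upwards [nhdsWithin_le_nhds (Metric.ball_mem_nhds (0 : ℝ) hη)] with s hs
    have hs : |s| < η := by simpa using hs
    have := norm_line_sub_le ha (p + s • b) s (δ p) (ε := ε) fun r hr => by
      have := @hη' (s, r) (by simpa [Prod.dist_eq] using ⟨hs, hr.trans_lt hs⟩)
      rw [← dist_eq_norm]
      exact this
    simpa using this
  refine (key.add hb).congr' ?_
  filter_upwards with s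
  simp only [zero_smul, add_zero, sub_add_cancel, smul_add]
  congr 3
  abel

/-- Chain rule: `f s = f 0 + s • q` with difference quotient `q → v`, and the mean value estimate is
applied on this segment in the varying direction `q`. Joint continuity of `dg` makes it uniform. -/
theorem HasVelocity.comp_curve [IsTopologicalAddGroup F] [ContinuousSMul ℝ F]
    {g : F → G} {dg : F × F → G} (hc : Continuous dg)
    (hg : ∀ x y, HasVelocity (fun s : ℝ => g (x + s • y)) (dg (x, y)))
    {f : ℝ → F} {v : F} (hf : HasVelocity f v) :
    HasVelocity (fun s => g (f s)) (dg (f 0, v)) := by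
  refine HasVelocity.of_eventually_norm_le fun ε hε => ?_
  have hc' : Continuous fun r : ℝ × F => dg (f 0 + r.1 • r.2, r.2) := by fun_prop
  have h0 : Tendsto (fun r : ℝ × F => dg (f 0 + r.1 • r.2, r.2)) (𝓝 (0, v))
      (𝓝 (dg (f 0, v))) := by
    simpa using hc'.tendsto (0, v)
  have h1 := h0.eventually (Metric.closedBall_mem_nhds (dg (f 0, v)) hε)
  rw [nhds_prod_eq, eventually_prod_iff] at h1
  obtain ⟨P, hP, Q, hQ, hPQ⟩ := h1
  obtain ⟨η, hη, hη'⟩ := Metric.eventually_nhds_iff.mp hP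
  filter_upwards [nhdsWithin_le_nhds (Metric.ball_mem_nhds (0 : ℝ) hη), self_mem_nhdsWithin,
    hf.eventually hQ] with s hs hs0 hq
  have hs : |s| < η := by simpa using hs
  have hs0 : s ≠ 0 := hs0
  have := norm_line_sub_le (fun q => hg q (s⁻¹ • (f s - f 0))) (f 0) s (dg (f 0, v)) (ε := ε)
    fun r hr => by
      rw [← dist_eq_norm]
      exact hPQ (hη' (by simpa using hr.trans_lt hs)) hq
  simpa [smul_smul, mul_inv_cancel₀ hs0] using this

theorem HasVelocity.prodMk {f : ℝ → E} {g : ℝ → F} {a : E} {b : F}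
    (hf : HasVelocity f a) (hg : HasVelocity g b) :
    HasVelocity (fun s => (f s, g s)) (a, b) :=
  Tendsto.prodMk_nhds hf hg

theorem HasVelocity.line [IsTopologicalAddGroup E] (x y : E) :
    HasVelocity (fun s : ℝ => x + s • y) y := by
  refine tendsto_const_nhds.congr' ?_
  filter_upwards [self_mem_nhdsWithin] with s hs
  have hs : s ≠ 0 := hs
  simp [smul_smul, inv_mul_cancel₀ hs]

end Velocity

/-- `f` is `n` times continuously differentiable, in terms of iterated total differentials
`df : E × E → F`. -/
def IsCn {F : Type v} [AddCommGroup F] [Module ℝ F] [TopologicalSpace F] :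
    ℕ → ∀ (E : Type u) [AddCommGroup E] [Module ℝ E] [TopologicalSpace E], (E → F) → Prop
  | 0, _, _, _, _, f => Continuous f
  | n + 1, E, _, _, _, f => Continuous f ∧ ∃ df : E × E → F,
      (∀ x y, HasVelocity (fun s : ℝ => f (x + s • y)) (df (x, y))) ∧ IsCn n (E × E) df

namespace IsCn

variable {F : Type*} [AddCommGroup F] [Module ℝ F] [TopologicalSpace F]
  {F' : Type*} [AddCommGroup F'] [Module ℝ F'] [TopologicalSpace F']

theorem continuous {n : ℕ} {E : Type u} [AddCommGroup E] [Module ℝ E] [TopologicalSpace E]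
    {f : E → F} (h : IsCn n E f) : Continuous f := by
  cases n with
  | zero => exact h
  | succ n => exact h.1

theorem of_succ {n : ℕ} : ∀ {E : Type u} [AddCommGroup E] [Module ℝ E] [TopologicalSpace E]
    {f : E → F}, IsCn (n + 1) E f → IsCn n E f := by
  induction n with
  | zero => exact fun h => h.1
  | succ n ih => exact fun ⟨h, df, h1, h2⟩ => ⟨h, df, h1, ih h2⟩

theorem comp_clm {n : ℕ} : ∀ {E : Type u} [AddCommGroup E] [Module ℝ E] [TopologicalSpace E]
    {E' : Type*} [AddCommGroup E'] [Module ℝ E'] [TopologicalSpace E']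
    {f : E' → F} (_ : IsCn n E' f) (L : E →L[ℝ] E'), IsCn n E fun x => f (L x) := by
  induction n with
  | zero => exact fun h L => Continuous.comp h L.continuous
  | succ n ih =>
    rintro E _ _ _ E' _ _ _ f ⟨h, df, h1, h2⟩ L
    refine ⟨h.comp L.continuous, fun p => df (L p.1, L p.2), fun x y => ?_,
      ih h2 (L.prodMap L)⟩
    simpa using h1 (L x) (L y)

theorem clm_comp {n : ℕ} : ∀ {E : Type u} [AddCommGroup E] [Module ℝ E] [TopologicalSpace E]
    {f : E → F} (_ : IsCn n E f) (L : F →L[ℝ] F'), IsCn n E fun x => L (f x) := by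
  induction n with
  | zero => exact fun h L => L.continuous.comp h
  | succ n ih =>
    rintro E _ _ _ f ⟨h, df, h1, h2⟩ L
    exact ⟨L.continuous.comp h, fun p => L (df p), fun x y => (h1 x y).map L, ih h2 L⟩

theorem prodMk {n : ℕ} : ∀ {E : Type u} [AddCommGroup E] [Module ℝ E] [TopologicalSpace E]
    {f : E → F} {g : E → F'} (_ : IsCn n E f) (_ : IsCn n E g),
    IsCn n E fun x => (f x, g x) := by
  induction n with
  | zero => exact fun hf hg => Continuous.prodMk hf hg
  | succ n ih =>
    rintro E _ _ _ f g ⟨h, df, h1, h2⟩ ⟨k, dg, k1, k2⟩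
    exact ⟨h.prodMk k, fun p => (df p, dg p), fun x y => (h1 x y).prodMk (k1 x y), ih h2 k2⟩

theorem add [IsTopologicalAddGroup F] {n : ℕ} :
    ∀ {E : Type u} [AddCommGroup E] [Module ℝ E] [TopologicalSpace E]
    {f g : E → F} (_ : IsCn n E f) (_ : IsCn n E g), IsCn n E fun x => f x + g x := by
  induction n with
  | zero => exact fun hf hg => Continuous.add hf hg
  | succ n ih =>
    rintro E _ _ _ f g ⟨h, df, h1, h2⟩ ⟨k, dg, k1, k2⟩
    exact ⟨h.add k, fun p => df p + dg p, fun x y => (h1 x y).add (k1 x y), ih h2 k2⟩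

theorem const {n : ℕ} : ∀ {E : Type u} [AddCommGroup E] [Module ℝ E] [TopologicalSpace E]
    (c : F), IsCn n E fun _ => c := by
  induction n with
  | zero => exact fun c => continuous_const
  | succ n ih =>
    exact fun c => ⟨continuous_const, fun _ => 0, fun x y => HasVelocity.const c, ih 0⟩

theorem clm {n : ℕ} {E : Type u} [AddCommGroup E] [Module ℝ E] [TopologicalSpace E]
    [IsTopologicalAddGroup F] (L : E →L[ℝ] F) : IsCn n E L := by
  cases n with
  | zero => exact L.continuous
  | succ n =>
    refine ⟨L.continuous, fun p => L p.2, fun x y => ?_, ?_⟩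
    · simpa using HasVelocity.line (L x) (L y)
    · induction n generalizing E with
      | zero => exact L.continuous.comp continuous_snd
      | succ n ih =>
        refine ⟨L.continuous.comp continuous_snd, fun p => L p.2.2, fun x y => ?_, ?_⟩
        · simpa using HasVelocity.line (L x.2) (L y.2)
        · exact ih (L.comp (ContinuousLinearMap.snd ℝ E E))

theorem sum [IsTopologicalAddGroup F] {n : ℕ} {ι : Type*} (J : Finset ι)
    {E : Type u} [AddCommGroup E] [Module ℝ E] [TopologicalSpace E]
    {f : ι → E → F} (h : ∀ i, IsCn n E (f i)) : IsCn n E fun x => ∑ i ∈ J, f i x := by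
  classical
  induction J using Finset.induction_on with
  | empty => simpa using const 0
  | insert i J hi ih => simpa [Finset.sum_insert hi] using (h i).add ih

theorem clm_smul [IsTopologicalAddGroup F] [ContinuousSMul ℝ F] {n : ℕ} :
    ∀ {E : Type u} [AddCommGroup E] [Module ℝ E] [TopologicalSpace E]
    [IsTopologicalAddGroup E] [ContinuousSMul ℝ E]
    {f : E → F} (_ : IsCn n E f) (L : E →L[ℝ] ℝ), IsCn n E fun x => L x • f x := by
  induction n with
  | zero => exact fun h L => Continuous.smul L.continuous h
  | succ n ih =>
    intro E _ _ _ _ _ f hf L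
    have hf' := hf.of_succ
    obtain ⟨h, df, h1, h2⟩ := hf
    refine ⟨L.continuous.smul h, fun p => L p.2 • f p.1 + L p.1 • df p, fun x y => ?_,
      (ih (hf'.comp_clm (ContinuousLinearMap.fst ℝ E E))
        (L.comp (ContinuousLinearMap.snd ℝ E E))).add
        (ih h2 (L.comp (ContinuousLinearMap.fst ℝ E E)))⟩
    have h3 : Tendsto (fun s : ℝ => f (x + s • y)) (𝓝[≠] 0) (𝓝 (f x)) := by
      have : Continuous fun s : ℝ => f (x + s • y) := h.comp (by fun_prop)
      simpa using (this.tendsto 0).mono_left nhdsWithin_le_nhds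
    refine ((h3.const_smul (L y)).add (Tendsto.const_smul (h1 x y) (L x))).congr' ?_
    filter_upwards [self_mem_nhdsWithin] with s hs
    have hs : s ≠ 0 := hs
    simp only [zero_smul, add_zero, map_add, map_smul, smul_eq_mul, add_smul, smul_sub, smul_add,
      smul_smul, ← mul_assoc, inv_mul_cancel₀ hs, one_mul, mul_comm (L x)]
    abel

/-- Continuous bilinear maps are smooth. -/
theorem bilin [IsTopologicalAddGroup F] [ContinuousSMul ℝ F] {n : ℕ} {W : Type*} [AddCommGroup W]
    [Module ℝ W] [TopologicalSpace W] {W' : Type*} [AddCommGroup W'] [Module ℝ W']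
    [TopologicalSpace W'] (B : W →ₗ[ℝ] W' →ₗ[ℝ] F)
    (hB : Continuous fun p : W × W' => B p.1 p.2) :
    ∀ {E : Type u} [AddCommGroup E] [Module ℝ E] [TopologicalSpace E]
    [IsTopologicalAddGroup E] [ContinuousSMul ℝ E]
    (L : E →L[ℝ] W) (L' : E →L[ℝ] W'), IsCn n E fun x => B (L x) (L' x) := by
  induction n with
  | zero => exact fun L L' => hB.comp (L.continuous.prodMk L'.continuous)
  | succ n ih =>
    intro E _ _ _ _ _ L L'
    refine ⟨hB.comp (L.continuous.prodMk L'.continuous),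
      fun p => B (L p.2) (L' p.1) + B (L p.1) (L' p.2), fun x y => ?_,
      (ih (L.comp (ContinuousLinearMap.snd ℝ E E)) (L'.comp (ContinuousLinearMap.fst ℝ E E))).add
      (ih (L.comp (ContinuousLinearMap.fst ℝ E E)) (L'.comp (ContinuousLinearMap.snd ℝ E E)))⟩
    have h3 : Tendsto (fun s : ℝ => B (L y) (L' (x + s • y))) (𝓝[≠] 0) (𝓝 (B (L y) (L' x))) := by
      have : Continuous fun s : ℝ => B (L y) (L' (x + s • y)) :=
        hB.comp (continuous_const.prodMk (L'.continuous.comp (by fun_prop)))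
      simpa using (this.tendsto 0).mono_left nhdsWithin_le_nhds
    refine (h3.add_const (B (L x) (L' y))).congr' ?_
    filter_upwards [self_mem_nhdsWithin] with s hs
    have hs : s ≠ 0 := hs
    simp only [zero_smul, add_zero, map_add, map_smul, LinearMap.add_apply, LinearMap.smul_apply,
      smul_sub, smul_add, smul_smul, ← mul_assoc, inv_mul_cancel₀ hs, one_mul, one_smul]
    abel

variable {G : Type*} [NormedAddCommGroup G] [NormedSpace ℝ G]

/-- The differential `dg (f x, df (x, y))` is again a composition, of `dg` with a map into `F × F`,
so the induction closes. This is the advantage of total differentials over multi-slot derivatives.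
-/
theorem comp {n : ℕ} : ∀ {E : Type u} [AddCommGroup E] [Module ℝ E] [TopologicalSpace E]
    {F : Type*} [AddCommGroup F] [Module ℝ F] [TopologicalSpace F] [IsTopologicalAddGroup F]
    [ContinuousSMul ℝ F] {g : F → G} {f : E → F}
    (_ : IsCn n F g) (_ : IsCn n E f), IsCn n E fun x => g (f x) := by
  induction n with
  | zero => exact fun hg hf => Continuous.comp hg hf
  | succ n ih =>
    intro E _ _ _ F _ _ _ _ _ g f hg hf
    have hf' := hf.of_succ
    obtain ⟨h, df, h1, h2⟩ := hf
    obtain ⟨k, dg, k1, k2⟩ := hg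
    refine ⟨k.comp h, fun p => dg (f p.1, df p), fun x y => ?_,
      ih k2 ((hf'.comp_clm (ContinuousLinearMap.fst ℝ E E)).prodMk h2)⟩
    simpa using HasVelocity.comp_curve k2.continuous k1 (h1 x y)

end IsCn

section Smooth

variable {E : Type u} [AddCommGroup E] [Module ℝ E] [TopologicalSpace E]
  [IsTopologicalAddGroup E] [ContinuousSMul ℝ E]
  {G : Type v} [NormedAddCommGroup G] [NormedSpace ℝ G]

/-- The iterated directional derivatives are multilinear. -/
theorem iterated_derivative_linear {d : (k : ℕ) → E → (Fin k → E) → G}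
    (hc : ∀ k, Continuous fun p : E × (Fin k → E) => d k p.1 p.2)
    (hd : ∀ (k : ℕ) (x : E) (h : Fin k → E) (y : E),
      HasVelocity (fun s : ℝ => d k (x + s • y) h)
        (d (k + 1) x (Fin.snoc (α := fun _ => E) h y))) (k : ℕ) :
    ∀ (x : E) (h : Fin k → E) (j : Fin k) (a b : E) (r : ℝ),
      d k x (Function.update h j (a + r • b)) =
        d k x (Function.update h j a) + r • d k x (Function.update h j b) := by
  induction k with
  | zero => exact fun _ _ j => j.elim0
  | succ k ih =>
    intro x h j a b r
    obtain ⟨g, y, rfl⟩ : ∃ (g : Fin k → E) (y : E), h = Fin.snoc (α := fun _ => E) g y :=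
      ⟨Fin.init h, h (Fin.last k), (Fin.snoc_init_self h).symm⟩
    cases j using Fin.lastCases with
    -- In the newest slot, linearity is additivity of directional derivatives.
    | last =>
      simp only [Fin.update_snoc_last]
      have h1 : HasVelocity (fun s : ℝ => d k (x + s • (r • b)) g)
          (r • d (k + 1) x (Fin.snoc (α := fun _ => E) g b)) := by
        simpa [smul_smul] using (hd k x g b).rescale r
      have h2 : Continuous fun q => d (k + 1) q (Fin.snoc (α := fun _ => E) g a) := by
        have := hc (k + 1)
        fun_prop
      have h3 : HasVelocity (fun s : ℝ => d k (x + s • (a + r • b)) g)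
          (d (k + 1) x (Fin.snoc (α := fun _ => E) g a) +
            r • d (k + 1) x (Fin.snoc (α := fun _ => E) g b)) :=
        HasVelocity.along_add (f := fun q => d k q g) h2 (fun q => hd k q g a) h1
      exact (hd k x g (a + r • b)).unique h3
    -- In older slots, linearity holds at level `k` and is differentiated in `x`.
    | cast j =>
      simp only [← Fin.snoc_update]
      refine (hd k x (Function.update g j (a + r • b)) y).unique ?_
      simp only [ih]
      refine (hd k x (Function.update g j a) y).add ?_
      exact (hd k x (Function.update g j b) y).map (r • ContinuousLinearMap.id ℝ G)

end Smooth

end Calculus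

/-! ### Smoothness in terms of iterated total differentials -/

section SmoothIff

variable {E : Type u} [AddCommGroup E] [Module ℝ E] [TopologicalSpace E]
  [IsTopologicalAddGroup E] [ContinuousSMul ℝ E]
  {G : Type v} [NormedAddCommGroup G] [NormedSpace ℝ G]

/-- `Fin.snoc` as a continuous linear map. -/
noncomputable def snocCLM (E : Type u) [AddCommGroup E] [Module ℝ E] [TopologicalSpace E] (k : ℕ) :
    ((Fin k → E) × E) →L[ℝ] (Fin (k + 1) → E) :=
  ContinuousLinearMap.pi fun i => Fin.lastCases (ContinuousLinearMap.snd ℝ (Fin k → E) E)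
    (fun j => (ContinuousLinearMap.proj j).comp (ContinuousLinearMap.fst ℝ (Fin k → E) E)) i

theorem snocCLM_apply (k : ℕ) (h : Fin k → E) (y : E) :
    snocCLM E k (h, y) = Fin.snoc (α := fun _ => E) h y := by
  funext i
  cases i using Fin.lastCases <;> simp [snocCLM]

/-- `Fin.init` as a continuous linear map. -/
noncomputable def initCLM (E : Type u) [AddCommGroup E] [Module ℝ E] [TopologicalSpace E] (k : ℕ) :
    (Fin (k + 1) → E) →L[ℝ] (Fin k → E) :=
  ContinuousLinearMap.pi fun i => ContinuousLinearMap.proj i.castSucc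

/-- `(h, h') ↦ Function.update h j (h' j)` as a continuous linear map. -/
noncomputable def updateCLM (E : Type u) [AddCommGroup E] [Module ℝ E] [TopologicalSpace E]
    {k : ℕ} (j : Fin k) : ((Fin k → E) × (Fin k → E)) →L[ℝ] (Fin k → E) :=
  ContinuousLinearMap.pi fun i =>
    if i = j then (ContinuousLinearMap.proj j).comp (ContinuousLinearMap.snd ℝ _ _)
    else (ContinuousLinearMap.proj i).comp (ContinuousLinearMap.fst ℝ _ _)

theorem updateCLM_apply {k : ℕ} (j : Fin k) (h h' : Fin k → E) :
    updateCLM E j (h, h') = Function.update h j (h' j) := by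
  funext i
  by_cases hi : i = j
  · subst hi
    simp [updateCLM]
  · simp [updateCLM, hi]

/-- Differentiating in `x` gives `d (k + 1)`; differentiating in a slot, where the map is affine,
replaces that slot by the increment. The total differential is the sum of these terms, adjoined slot
by slot with `HasVelocity.along_add`, and is built from the same family `d`. -/
theorem isCn_iterated_derivative {d : (k : ℕ) → E → (Fin k → E) → G}
    (hc : ∀ k, Continuous fun p : E × (Fin k → E) => d k p.1 p.2)
    (hd : ∀ (k : ℕ) (x : E) (h : Fin k → E) (y : E),
      HasVelocity (fun s : ℝ => d k (x + s • y) h)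
        (d (k + 1) x (Fin.snoc (α := fun _ => E) h y))) (n : ℕ) :
    ∀ k : ℕ, IsCn n (E × (Fin k → E)) fun p => d k p.1 p.2 := by
  induction n with
  | zero => exact fun k => hc k
  | succ n ih =>
    intro k
    have hupd : ∀ (j : Fin k) (c : E),
        Continuous fun p : E × (Fin k → E) => d k p.1 (Function.update p.2 j c) := fun j c =>
      (hc k).comp (continuous_fst.prodMk (continuous_snd.update j continuous_const))
    have hpart : ∀ (j : Fin k) (c : E) (p : E × (Fin k → E)),
        HasVelocity (fun s : ℝ => d k (p + s • ((0 : E), Pi.single j c)).1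
          (p + s • ((0 : E), Pi.single j c)).2) (d k p.1 (Function.update p.2 j c)) := by
      intro j c p
      have : ∀ s : ℝ, d k (p + s • ((0 : E), Pi.single j c)).1
          (p + s • ((0 : E), Pi.single j c)).2 =
          d k p.1 p.2 + s • d k p.1 (Function.update p.2 j c) := by
        intro s
        have h1 := iterated_derivative_linear hc hd k p.1 p.2 j (p.2 j) c s
        rw [Function.update_eq_self] at h1
        rw [← h1]
        have h2 : (p + s • ((0 : E), Pi.single j c)).2 =
            Function.update p.2 j (p.2 j + s • c) := by
          funext i
          by_cases hi : i = j
          · subst hi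
            simp
          · simp [hi]
        rw [h2]
        simp
      simp only [this]
      exact HasVelocity.line _ _
    have htot : ∀ (J : Finset (Fin k)) (p q : E × (Fin k → E)),
        HasVelocity (fun s : ℝ => d k (p + s • (q.1, ∑ j ∈ J, Pi.single j (q.2 j))).1
            (p + s • (q.1, ∑ j ∈ J, Pi.single j (q.2 j))).2)
          (d (k + 1) p.1 (Fin.snoc (α := fun _ => E) p.2 q.1) +
            ∑ j ∈ J, d k p.1 (Function.update p.2 j (q.2 j))) := by
      intro J p q
      induction J using Finset.induction_on with
      | empty => simpa using hd k p.1 p.2 q.1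
      | insert i J hi ihJ =>
        have h1 := HasVelocity.along_add (f := fun p : E × (Fin k → E) => d k p.1 p.2)
          (hupd i (q.2 i)) (hpart i (q.2 i)) ihJ
        rw [Finset.sum_insert hi, Finset.sum_insert hi, add_left_comm]
        simpa only [Prod.mk_add_mk, zero_add] using h1
    refine ⟨hc k, fun r => d (k + 1) r.1.1 (Fin.snoc (α := fun _ => E) r.1.2 r.2.1) +
      ∑ j, d k r.1.1 (Function.update r.1.2 j (r.2.2 j)), fun p q => ?_, ?_⟩
    · have h1 := htot Finset.univ p q
      rwa [Finset.univ_sum_single] at h1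
    · refine IsCn.add ?_ (IsCn.sum _ fun j => ?_)
      · have h1 := (ih (k + 1)).comp_clm
          (((ContinuousLinearMap.fst ℝ E (Fin k → E)).comp
            (ContinuousLinearMap.fst ℝ (E × (Fin k → E)) (E × (Fin k → E)))).prod
          ((snocCLM E k).comp (((ContinuousLinearMap.snd ℝ E (Fin k → E)).comp
            (ContinuousLinearMap.fst ℝ (E × (Fin k → E)) (E × (Fin k → E)))).prod
            ((ContinuousLinearMap.fst ℝ E (Fin k → E)).comp
            (ContinuousLinearMap.snd ℝ (E × (Fin k → E)) (E × (Fin k → E)))))))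
        simpa [snocCLM_apply] using h1
      · have h1 := (ih k).comp_clm
          (((ContinuousLinearMap.fst ℝ E (Fin k → E)).comp
            (ContinuousLinearMap.fst ℝ (E × (Fin k → E)) (E × (Fin k → E)))).prod
          ((updateCLM E j).comp ((ContinuousLinearMap.snd ℝ E (Fin k → E)).prodMap
            (ContinuousLinearMap.snd ℝ E (Fin k → E)))))
        simpa [updateCLM_apply, Prod.map] using h1

theorem IsSmoothMap.isCn {f : E → G} (hf : IsSmoothMap f) (n : ℕ) : IsCn n E f := by
  obtain ⟨d, h0, hc, hd⟩ := hf
  have h1 := (isCn_iterated_derivative hc hd n 0).comp_clm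
    ((ContinuousLinearMap.id ℝ E).prod (0 : E →L[ℝ] (Fin 0 → E)))
  simpa [h0] using h1

/-- Iterated directional derivatives of a function with values in a normed space. -/
noncomputable def iteratedDirDeriv (f : E → G) : (k : ℕ) → E → (Fin k → E) → G
  | 0, x, _ => f x
  | k + 1, x, h =>
    deriv (fun s : ℝ => iteratedDirDeriv f k (x + s • h (Fin.last k)) (Fin.init h)) 0

/-- Each further directional derivative is the total differential of the previous one restricted to
increments `(y, 0)`, hence remains `IsCn n` for every `n`. -/
theorem isSmoothMap_of_isCn {f : E → G} (hf : ∀ n, IsCn n E f) : IsSmoothMap f := by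
  have key : ∀ k n, IsCn n (E × (Fin k → E)) fun p => iteratedDirDeriv f k p.1 p.2 := by
    intro k
    induction k with
    | zero => exact fun n => (hf n).comp_clm (ContinuousLinearMap.fst ℝ E (Fin 0 → E))
    | succ k ih =>
      intro n
      obtain ⟨-, df, h1, h2⟩ := ih (n + 1)
      have h3 := h2.comp_clm (((ContinuousLinearMap.fst ℝ E (Fin (k + 1) → E)).prod
        ((initCLM E k).comp (ContinuousLinearMap.snd ℝ E (Fin (k + 1) → E)))).prod
        (((ContinuousLinearMap.proj (Fin.last k)).comp
          (ContinuousLinearMap.snd ℝ E (Fin (k + 1) → E))).prod 0))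
      convert h3 using 2 with p
      have h4 := hasVelocity_iff_hasDerivAt.mp (h1 (p.1, Fin.init p.2) (p.2 (Fin.last k), 0))
      simp only [Prod.smul_mk, Prod.mk_add_mk, smul_zero, add_zero] at h4
      exact h4.deriv
  refine ⟨iteratedDirDeriv f, fun _ _ => rfl, fun k => (key k 0).continuous, fun k x h y => ?_⟩
  obtain ⟨-, df, h1, -⟩ := key k 1
  have h4 := hasVelocity_iff_hasDerivAt.mp (h1 (x, h) (y, 0))
  simp only [Prod.smul_mk, Prod.mk_add_mk, smul_zero, add_zero] at h4
  rw [hasVelocity_iff_hasDerivAt]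
  simpa [iteratedDirDeriv] using h4.differentiableAt.hasDerivAt

end SmoothIff

/-! ### Smoothness of right translations -/

section Translation

variable {V : Type u} [AddCommGroup V] [Module ℝ V] [TopologicalSpace V]
  [IsTopologicalAddGroup V] [ContinuousSMul ℝ V] [T2Space V]

theorem OscillatorData.hasVelocity_γ (S : OscillatorData V) (t r : ℝ) (v : V) :
    HasVelocity (fun s : ℝ => S.γ (t + s * r) v) (r • S.γ t (S.D v)) := by
  have := ((S.D_spec v).rescale r).map (S.γ t)
  simpa [← S.γ_add_apply] using this

/-- The derivative of `γ(t)v` in `t` is `γ(t)Dv`, an orbit map of the same kind, so induction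
applies even though `V` is not normed. -/
theorem OscillatorData.isCn_γ (S : OscillatorData V) {n : ℕ} :
    ∀ {E : Type u} [AddCommGroup E] [Module ℝ E] [TopologicalSpace E] [IsTopologicalAddGroup E]
    [ContinuousSMul ℝ E] (L : E →L[ℝ] ℝ) (v : V), IsCn n E fun x => S.γ (L x) v := by
  induction n with
  | zero => exact fun L v => (S.continuous_γ_apply v).comp L.continuous
  | succ n ih =>
    intro E _ _ _ _ _ L v
    refine ⟨(S.continuous_γ_apply v).comp L.continuous,
      fun p => L p.2 • S.γ (L p.1) (S.D v), fun x y => ?_, ?_⟩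
    · simpa using S.hasVelocity_γ (L x) (L y) v
    · exact (ih (L.comp (ContinuousLinearMap.fst ℝ E E)) (S.D v)).clm_smul
        (L.comp (ContinuousLinearMap.snd ℝ E E))

/-- Right translations of the oscillator group are smooth in the global chart. -/
theorem OscillatorGroup.isCn_mul_right {S : OscillatorData V} (g : OscillatorGroup S) (n : ℕ) :
    IsCn n (ℝ × V × ℝ) fun x => (ofVec S x * g).toVec := by
  have hV : IsCn n (ℝ × V × ℝ) fun x => x.2.1 :=
    IsCn.clm ((ContinuousLinearMap.fst ℝ V ℝ).comp (ContinuousLinearMap.snd ℝ ℝ (V × ℝ)))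
  have hγ : IsCn n (ℝ × V × ℝ) fun x => S.γ x.2.2 g.v :=
    S.isCn_γ ((ContinuousLinearMap.snd ℝ V ℝ).comp (ContinuousLinearMap.snd ℝ ℝ (V × ℝ))) g.v
  have hω : IsCn n (V × V) fun p : V × V => S.ω p.1 p.2 :=
    IsCn.bilin S.ω S.ω_continuous (ContinuousLinearMap.fst ℝ V V) (ContinuousLinearMap.snd ℝ V V)
  have h1 : IsCn n (ℝ × V × ℝ) fun x => 1 / 2 * S.ω x.2.1 (S.γ x.2.2 g.v) :=
    (IsCn.comp hω (hV.prodMk hγ)).clm_comp ((1 / 2 : ℝ) • ContinuousLinearMap.id ℝ ℝ)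
  have h2 : IsCn n (ℝ × V × ℝ) fun x => x.1 := IsCn.clm (ContinuousLinearMap.fst ℝ ℝ (V × ℝ))
  have h3 : IsCn n (ℝ × V × ℝ) fun x => x.2.2 :=
    IsCn.clm ((ContinuousLinearMap.snd ℝ V ℝ).comp (ContinuousLinearMap.snd ℝ ℝ (V × ℝ)))
  exact ((h2.add (IsCn.const g.z)).add h1).prodMk ((hV.add hγ).prodMk (h3.add (IsCn.const g.t)))

end Translation

/-! ### Invariance of the smooth vectors -/

section SmoothVectors

variable {V : Type u} [AddCommGroup V] [Module ℝ V] [TopologicalSpace V]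
  [IsTopologicalAddGroup V] [ContinuousSMul ℝ V] {S : OscillatorData V}
  {H : Type v} [NormedAddCommGroup H] [InnerProductSpace ℂ H] [CompleteSpace H]
  (π : OscillatorGroup S →* unitary (H →L[ℂ] H))

theorem rep_mul_apply (g h : OscillatorGroup S) (ξ : H) :
    (π (g * h) : H →L[ℂ] H) ξ = (π g : H →L[ℂ] H) ((π h : H →L[ℂ] H) ξ) := by
  simp

theorem rep_one_apply (ξ : H) : (π 1 : H →L[ℂ] H) ξ = ξ := by
  simp

theorem rep_inner (g : OscillatorGroup S) (ξ η : H) :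
    ⟪(π g : H →L[ℂ] H) ξ, (π g : H →L[ℂ] H) η⟫_ℂ = ⟪ξ, η⟫_ℂ := by
  rw [← ContinuousLinearMap.adjoint_inner_right, ← ContinuousLinearMap.star_eq_adjoint,
    ← mul_apply_eq_comp, Unitary.coe_star_mul_self, one_apply_eq_self]

theorem rep_norm (g : OscillatorGroup S) (ξ : H) : ‖(π g : H →L[ℂ] H) ξ‖ = ‖ξ‖ := by
  rw [@norm_eq_sqrt_re_inner ℂ, rep_inner, ← @norm_eq_sqrt_re_inner ℂ]

/-- The orbit map of `π(g)ξ` is that of `ξ` composed with right translation by `g`. -/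
theorem rep_mem_smoothVectors [T2Space V] (g : OscillatorGroup S) {ξ : H}
    (hξ : ξ ∈ smoothVectors π) : (π g : H →L[ℂ] H) ξ ∈ smoothVectors π := by
  refine isSmoothMap_of_isCn fun n => ?_
  have h1 := IsCn.comp (IsSmoothMap.isCn (f := orbitMap π ξ) hξ n)
    (OscillatorGroup.isCn_mul_right g n)
  convert h1 using 2 with x
  exact (rep_mul_apply π (OscillatorGroup.ofVec S x) g ξ).symm

end SmoothVectors

/-! ### From numerical bounds to spectral bounds -/

section Spectrum

variable {H : Type v} [NormedAddCommGroup H] [InnerProductSpace ℂ H]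

/-- Cauchy–Schwarz applied to `Re ⟨v, (μ - A)v⟩ ≥ (Re μ - C)‖v‖²`. -/
theorem IsBoundedAboveBy.mul_norm_le {A : H →ₗ.[ℂ] H} {C : ℝ} (hA : IsBoundedAboveBy A C)
    (μ : ℂ) (v : A.domain) : (μ.re - C) * ‖(v : H)‖ ≤ ‖A v - μ • (v : H)‖ := by
  have h1 : (μ.re - C) * ‖(v : H)‖ ^ 2 ≤ ‖(v : H)‖ * ‖A v - μ • (v : H)‖ := by
    have h2 : (⟪(v : H), A v - μ • (v : H)⟫_ℂ).re =
        (⟪(v : H), A v⟫_ℂ).re - μ.re * ‖(v : H)‖ ^ 2 := by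
      rw [inner_sub_right, inner_smul_right, inner_self_eq_norm_sq_to_K]
      simp [← Complex.ofReal_pow]
    have h3 := (Complex.abs_re_le_norm _).trans
      (norm_inner_le_norm (𝕜 := ℂ) (v : H) (A v - μ • (v : H)))
    have h4 := neg_abs_le (⟪(v : H), A v - μ • (v : H)⟫_ℂ).re
    have h5 := hA v
    linarith
  rcases (norm_nonneg (v : H)).eq_or_lt with h0 | h0
  · rw [← h0]
    simp
  · refine le_of_mul_le_mul_left ?_ h0
    linarith

variable [CompleteSpace H]

/-- The range of `A - μ`. -/
def shiftedRange (A : H →ₗ.[ℂ] H) (μ : ℂ) : Submodule ℂ H :=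
  LinearMap.range (A.toFun - μ • A.domain.subtype)

theorem mem_shiftedRange {A : H →ₗ.[ℂ] H} {μ : ℂ} (v : A.domain) :
    A v - μ • (v : H) ∈ shiftedRange A μ := ⟨v, rfl⟩

/-- Density of the range passes from `μ = r + iε` to `r` by perturbation: if `ψ` is orthogonal to
the range at `r` and `w = (A - μ)v` is close to `ψ`, then `⟨ψ, w⟩ = -iε⟨ψ, v⟩`, while `‖v‖ ≤
‖w‖/(2ε)` because `r - C = 2ε`. So `⟨ψ, w⟩` is too small for `w` to approximate `ψ`. -/
theorem IsBoundedAboveBy.shiftedRange_orthogonal_eq_bot {A : H →ₗ.[ℂ] H} {C : ℝ}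
    (hA : IsBoundedAboveBy A C) (hd : ∀ μ : ℂ, 0 < μ.im → (shiftedRange A μ)ᗮ = ⊥) {r : ℝ}
    (hr : C < r) : (shiftedRange A (r : ℂ))ᗮ = ⊥ := by
  rw [Submodule.eq_bot_iff]
  intro ψ hψ
  by_contra h0
  have hn : 0 < ‖ψ‖ := norm_pos_iff.mpr h0
  set ε : ℝ := (r - C) / 2 with hε
  have hε0 : 0 < ε := by linarith
  set μ : ℂ := ⟨r, ε⟩ with hμ
  have hcl : ψ ∈ closure (shiftedRange A μ : Set H) := by
    have := (Submodule.topologicalClosure_eq_top_iff (K := shiftedRange A μ)).mpr (hd μ hε0)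
    rw [← Submodule.topologicalClosure_coe, this]
    trivial
  obtain ⟨y, ⟨v, rfl⟩, hy⟩ := Metric.mem_closure_iff.mp hcl (‖ψ‖ / 4) (by positivity)
  set w : H := A v - μ • (v : H) with hw
  change dist ψ w < ‖ψ‖ / 4 at hy
  rw [dist_eq_norm] at hy
  have h1 : ⟪ψ, w⟫_ℂ = -(Complex.I * ε) * ⟪ψ, (v : H)⟫_ℂ := by
    have h2 : ⟪ψ, A v - (r : ℂ) • (v : H)⟫_ℂ = 0 :=
      (Submodule.mem_orthogonal' _ _).mp hψ _ (mem_shiftedRange v)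
    have h3 : w = (A v - (r : ℂ) • (v : H)) - (Complex.I * ε) • (v : H) := by
      have : μ = r + Complex.I * ε := by apply Complex.ext <;> simp [hμ]
      rw [hw, this, add_smul]
      abel
    rw [h3, inner_sub_right, h2, inner_smul_right]
    ring
  have h4 : ‖⟪ψ, w⟫_ℂ‖ ≤ ε * (‖ψ‖ * ‖(v : H)‖) := by
    rw [h1]
    simp only [norm_mul, norm_neg, Complex.norm_I, one_mul, Complex.norm_real, Real.norm_eq_abs,
      abs_of_pos hε0]
    gcongr
    exact norm_inner_le_norm _ _
  have h5 : 2 * ε * ‖(v : H)‖ ≤ ‖w‖ := by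
    have := hA.mul_norm_le μ v
    have h6 : μ.re - C = 2 * ε := by rw [hε]; ring
    rwa [h6] at this
  have h6 : ‖w‖ ≤ ‖ψ‖ + ‖ψ‖ / 4 := by
    have := norm_le_norm_add_norm_sub ψ w
    linarith
  have h7 : ‖ψ‖ ^ 2 ≤ ‖⟪ψ, w⟫_ℂ‖ + ‖ψ‖ * (‖ψ‖ / 4) := by
    have h8 : ‖⟪ψ, ψ⟫_ℂ‖ = ‖ψ‖ ^ 2 := by
      rw [inner_self_eq_norm_sq_to_K]
      simp
    have h9 : ⟪ψ, ψ⟫_ℂ = ⟪ψ, w⟫_ℂ + ⟪ψ, ψ - w⟫_ℂ := by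
      rw [← inner_add_right, add_sub_cancel]
    rw [← h8]
    conv_lhs => rw [h9]
    refine (norm_add_le _ _).trans ?_
    gcongr
    refine (norm_inner_le_norm _ _).trans ?_
    gcongr
  have h10 : ε * (‖ψ‖ * ‖(v : H)‖) ≤ ‖ψ‖ * ((‖ψ‖ + ‖ψ‖ / 4) / 2) := by
    have : ε * ‖(v : H)‖ ≤ (‖ψ‖ + ‖ψ‖ / 4) / 2 := by linarith
    calc ε * (‖ψ‖ * ‖(v : H)‖) = ‖ψ‖ * (ε * ‖(v : H)‖) := by ring
      _ ≤ _ := by gcongr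
  -- The estimates add up to `‖ψ‖² ≤ (5/8 + 1/4)‖ψ‖²`.
  nlinarith [pow_pos hn 2]

/-- A closable operator that is bounded above, and all of whose ranges `A - μ` with `Im μ > 0` are
dense, has no real spectrum above its bound. -/
theorem IsBoundedAboveBy.supSpec_le {A : H →ₗ.[ℂ] H} {C : ℝ} (hA : IsBoundedAboveBy A C)
    (hcl : A.IsClosable) (hd : ∀ μ : ℂ, 0 < μ.im → (shiftedRange A μ)ᗮ = ⊥) :
    supSpec A ≤ (C : EReal) := by
  refine iSup₂_le fun r hr => ?_
  by_contra hlt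
  have hlt : C < r := by simpa using hlt
  refine hr ?_
  set B := A.closure with hB
  have hBc : IsClosed (B.graph : Set (H × H)) := hcl.closure_isClosed
  have hgr : (B.graph : Set (H × H)) = closure (A.graph : Set (H × H)) := by
    rw [← hcl.graph_closure_eq_closure_graph, Submodule.topologicalClosure_coe]
  have : CompleteSpace B.graph := hBc.completeSpace_coe
  -- On the complete space `B.graph`, the operator `B - r` becomes the bounded map `(v, w) ↦ w - r
  -- v`. It is bounded below, so it is injective with closed range; the range is also dense. The
  -- resolvent is its inverse followed by the first projection.
  let Φ : B.graph →L[ℂ] H := ((ContinuousLinearMap.snd ℂ H H) -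
    (r : ℂ) • (ContinuousLinearMap.fst ℂ H H)).comp B.graph.subtypeL
  have hΦ : ∀ p : B.graph, Φ p = (p : H × H).2 - (r : ℂ) • (p : H × H).1 := fun p => rfl
  have hbound : ∀ p ∈ (B.graph : Set (H × H)), (r - C) * ‖p.1‖ ≤ ‖p.2 - (r : ℂ) • p.1‖ := by
    rw [hgr]
    intro p hp
    refine closure_minimal (s := (A.graph : Set (H × H)))
      (t := {p : H × H | (r - C) * ‖p.1‖ ≤ ‖p.2 - (r : ℂ) • p.1‖}) ?_ ?_ hp
    · intro q hq
      obtain ⟨v, hv1, hv2⟩ := (LinearPMap.mem_graph_iff A).mp hq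
      rw [Set.mem_ofPred_eq, ← hv1, ← hv2]
      simpa using hA.mul_norm_le (r : ℂ) v
    · exact isClosed_le (by fun_prop) (by fun_prop)
  have hpos : 0 < r - C := sub_pos.mpr hlt
  have hanti : ∀ p : B.graph, ‖p‖ ≤ (1 + (1 + |r|) / (r - C)) * ‖Φ p‖ := by
    intro p
    have h1 := hbound p p.2
    rw [← hΦ] at h1
    have h2 : ‖(p : H × H).1‖ ≤ ‖Φ p‖ / (r - C) := by
      rw [le_div_iff₀ hpos]
      linarith
    have h3 : ‖(p : H × H).2‖ ≤ ‖Φ p‖ + |r| * ‖(p : H × H).1‖ := by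
      have h4 : (p : H × H).2 = Φ p + (r : ℂ) • (p : H × H).1 := by rw [hΦ]; abel
      conv_lhs => rw [h4]
      refine (norm_add_le _ _).trans ?_
      simp [norm_smul]
    have h5 : |r| * ‖(p : H × H).1‖ ≤ |r| * (‖Φ p‖ / (r - C)) := by gcongr
    have h6 : 0 ≤ ‖Φ p‖ / (r - C) := by positivity
    have h7 : (1 + (1 + |r|) / (r - C)) * ‖Φ p‖ =
        ‖Φ p‖ + ‖Φ p‖ / (r - C) + |r| * (‖Φ p‖ / (r - C)) := by ring
    have h8 : 0 ≤ |r| * (‖Φ p‖ / (r - C)) := by positivity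
    rw [h7, Submodule.coe_norm, Prod.norm_def]
    exact max_le (by linarith [norm_nonneg (Φ p)]) (by linarith)
  have hker : Φ.ker = ⊥ := by
    rw [LinearMap.ker_eq_bot']
    intro p hp
    have h1 := hanti p
    have hp : Φ p = 0 := hp
    rw [hp, norm_zero, mul_zero] at h1
    exact norm_le_zero_iff.mp h1
  have hclosed : IsClosed (Set.range Φ) := by
    have hK : 0 ≤ 1 + (1 + |r|) / (r - C) := by positivity
    refine (AddMonoidHomClass.antilipschitz_of_bound Φ (K := ⟨_, hK⟩) hanti).isClosed_range
      Φ.uniformContinuous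
  have hrange : Φ.range = ⊤ := by
    have h1 : (shiftedRange A (r : ℂ) : Set H) ⊆ Set.range Φ := by
      rintro _ ⟨v, rfl⟩
      have h2 : ((v : H), A v) ∈ B.graph := by
        have h3 : ((v : H), A v) ∈ (B.graph : Set (H × H)) := by
          rw [hgr]
          exact subset_closure (LinearPMap.mem_graph A v)
        exact h3
      exact ⟨⟨_, h2⟩, rfl⟩
    have h2 := (Submodule.topologicalClosure_eq_top_iff (K := shiftedRange A (r : ℂ))).mpr
      (hA.shiftedRange_orthogonal_eq_bot hd hlt)
    rw [eq_top_iff]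
    intro y _
    have h3 : y ∈ closure (shiftedRange A (r : ℂ) : Set H) := by
      rw [← Submodule.topologicalClosure_coe, h2]
      trivial
    exact closure_minimal h1 hclosed h3
  let e := ContinuousLinearEquiv.ofBijective Φ hker hrange
  have he : ∀ p, e p = Φ p := fun p => rfl
  refine ⟨(ContinuousLinearMap.fst ℂ H H).comp (B.graph.subtypeL.comp (e.symm : H →L[ℂ] B.graph)),
    fun y => ?_, fun x => ?_⟩
  · obtain ⟨x, hx1, hx2⟩ := (LinearPMap.mem_graph_iff B).mp (e.symm y).2
    have h1 : Φ (e.symm y) = y := by rw [← he, e.apply_symm_apply]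
    rw [hΦ] at h1
    refine ⟨?_, ?_⟩
    · change ((e.symm y : B.graph) : H × H).1 ∈ B.domain
      rw [← hx1]
      exact x.2
    · have h2 : B ⟨((e.symm y : B.graph) : H × H).1, hx1 ▸ x.2⟩ =
          ((e.symm y : B.graph) : H × H).2 := by
        rw [← hx2]
        congr 1
        exact Subtype.ext hx1.symm
      change B ⟨((e.symm y : B.graph) : H × H).1, _⟩ -
        (r : ℂ) • ((e.symm y : B.graph) : H × H).1 = y
      rw [h2, h1]
  · have h1 : e ⟨((x : H), B x), LinearPMap.mem_graph B x⟩ = B x - (r : ℂ) • (x : H) := rfl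
    rw [← h1]
    simp

end Spectrum

/-! ### Consequences of a semi-equicontinuous coadjoint orbit -/

section SemiEquicontinuous

variable {V : Type u} [AddCommGroup V] [Module ℝ V] [TopologicalSpace V]
  [IsTopologicalAddGroup V] [ContinuousSMul ℝ V] [T2Space V]

theorem sq_le_of_forall_quadratic_nonneg {a b c : ℝ} (h : ∀ s : ℝ, 0 ≤ a * (s * s) + b * s + c) :
    b ^ 2 ≤ 4 * a * c := by
  have := discrim_le_zero h
  rw [discrim] at this
  linarith

theorem eq_zero_of_forall_mul_le {b c : ℝ} (h : ∀ s : ℝ, b * s ≤ c) : b = 0 := by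
  have := sq_le_of_forall_quadratic_nonneg (a := 0) (b := -b) (c := c) fun s => by
    linarith [h s]
  nlinarith

/-- The value of the adjoint action of `u ∈ V`. -/
theorem OscillatorGroup.Ad_vec_apply (S : OscillatorData V) (u : V) (x : ℝ × V × ℝ) :
    OscillatorGroup.Ad (⟨0, u, 0⟩ : OscillatorGroup S) x =
      (x.1 + S.ω u x.2.1 + 1 / 2 * x.2.2 * S.ω (S.D u) u, x.2.1 - x.2.2 • S.D u, x.2.2) := by
  simp [Ad, S.γ_zero_apply]

theorem continuousLinearMap_split (l : (ℝ × V × ℝ) →L[ℝ] ℝ) (x : ℝ × V × ℝ) :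
    l x = x.1 * l (1, 0, 0) + l (0, x.2.1, 0) + x.2.2 * l (0, 0, 1) := by
  have h : x = x.1 • ((1 : ℝ), (0 : V), (0 : ℝ)) + (0, x.2.1, 0) + x.2.2 • (0, 0, 1) := by
    ext <;> simp
  conv_lhs => rw [h]
  rw [map_add, map_add, map_smul, map_smul, smul_eq_mul, smul_eq_mul]

/-- Evaluating the orbit bound at `Ad (0,su,0)` gives a quadratic polynomial in `s` that is
nonnegative for every base point near `x₀`. Comparing its discriminants at two base points differing
by `Du` isolates `ω(u, Du)`. -/
theorem exists_hamiltonian_bound (S : OscillatorData V)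
    (hOrbit : ∃ l : (ℝ × V × ℝ) →L[ℝ] ℝ,
      coadjointOrbit S l ≠ {l} ∧ IsSemiEquicontinuous (coadjointOrbit S l))
    (hD : DenseRange S.D) (hq : ∀ u, 0 ≤ S.ω (S.D u) u) :
    ∃ W ∈ 𝓝 (0 : V), ∃ M : ℝ, 0 ≤ M ∧ ∀ u, S.D u ∈ W → S.ω (S.D u) u ≤ M := by
  obtain ⟨l, hne, x₀, U, hU, C, hC⟩ := hOrbit
  have hC' : ∀ x ∈ U, ∀ g : OscillatorGroup S, l (OscillatorGroup.Ad g (-x)) ≤ C := by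
    intro x hx g
    have h1 : l.comp (OscillatorGroup.Ad g⁻¹⁻¹) ∈ coadjointOrbit S l := ⟨g⁻¹, rfl⟩
    rw [inv_inv] at h1
    have h2 := (le_iSup₂ (f := fun (α : (ℝ × V × ℝ) →L[ℝ] ℝ) (_ : α ∈ coadjointOrbit S l) =>
      ((α (-x) : ℝ) : EReal)) _ h1).trans (hC x hx)
    exact_mod_cast h2
  set ζ := l (1, 0, 0) with hζ
  set τ := l (0, 0, 1) with hτ
  have hα : ∀ v w : V, l (0, v + w, 0) = l (0, v, 0) + l (0, w, 0) := fun v w => by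
    rw [← map_add]; simp
  have hαs : ∀ (c : ℝ) (v : V), l (0, c • v, 0) = c * l (0, v, 0) := fun c v => by
    rw [← smul_eq_mul, ← map_smul]; simp
  have hαn : ∀ v : V, l (0, -v, 0) = -l (0, v, 0) := fun v => by
    rw [← map_neg]; simp
  have hαc : Continuous fun v : V => l (0, v, 0) := by fun_prop
  have hmain : ∀ x ∈ U, ∀ u : V, ζ * (-x.1 - S.ω u x.2.1 - 1 / 2 * x.2.2 * S.ω (S.D u) u)
      - l (0, x.2.1, 0) + x.2.2 * l (0, S.D u, 0) - x.2.2 * τ ≤ C := by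
    intro x hx u
    have h1 := hC' x hx ⟨0, u, 0⟩
    rw [OscillatorGroup.Ad_vec_apply, continuousLinearMap_split] at h1
    simp only [Prod.fst_neg, Prod.snd_neg, map_neg, neg_smul, sub_neg_eq_add, hα, hαs, hαn] at h1
    linarith
  -- The last coordinate of the base point is moved off zero, so that `t₁ * l (0, Du, 0)` determines
  -- `l (0, Du, 0)`.
  obtain ⟨t₁, ht₁, W₀, hW₀, hWU⟩ : ∃ t₁ : ℝ, t₁ ≠ 0 ∧ ∃ W₀ ∈ 𝓝 (0 : V), ∀ h ∈ W₀,
      (x₀.1, x₀.2.1 + h, t₁) ∈ U := by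
    have hc : Tendsto (fun p : ℝ × V => (x₀.1, x₀.2.1 + p.2, x₀.2.2 + p.1)) (𝓝 0 ×ˢ 𝓝 0)
        (𝓝 x₀) := by
      have h1 : Continuous fun p : ℝ × V => (x₀.1, x₀.2.1 + p.2, x₀.2.2 + p.1) := by fun_prop
      rw [← nhds_prod_eq]
      simpa using h1.tendsto ((0 : ℝ), (0 : V))
    obtain ⟨P, hP, Q, hQ, hPQ⟩ := eventually_prod_iff.mp (hc.eventually hU)
    have h2 : ∀ᶠ t in 𝓝[≠] (0 : ℝ), P t ∧ x₀.2.2 + t ≠ 0 := by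
      refine (hP.filter_mono nhdsWithin_le_nhds).and ?_
      by_cases h0 : x₀.2.2 = 0
      · filter_upwards [self_mem_nhdsWithin] with t ht
        simpa [h0] using ht
      · have h3 : Continuous fun t : ℝ => x₀.2.2 + t := by fun_prop
        exact (h3.continuousAt.eventually_ne (by simpa using h0)).filter_mono nhdsWithin_le_nhds
    obtain ⟨t, ht, ht0⟩ := h2.exists
    exact ⟨_, ht0, {h | Q h}, hQ, fun h hh => hPQ ht hh⟩
  have hmain₁ : ∀ h ∈ W₀, ∀ (u : V) (s : ℝ),
      0 ≤ (ζ * t₁ / 2 * S.ω (S.D u) u) * (s * s) +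
        (ζ * S.ω u (x₀.2.1 + h) - t₁ * l (0, S.D u, 0)) * s +
        (C + ζ * x₀.1 + l (0, x₀.2.1, 0) + l (0, h, 0) + t₁ * τ) := by
    intro h hh u s
    have h1 := hmain _ (hWU h hh) (s • u)
    simp only [map_smul, LinearMap.smul_apply, smul_eq_mul, hα, hαs] at h1
    nlinarith
  -- If `l` vanishes on the centre, the polynomial is affine, so `l` vanishes on the range of `D`
  -- and, by density, on `V`. Then `l` depends only on the last coordinate, which `Ad` fixes, and
  -- the orbit is trivial.
  by_cases hζ0 : ζ = 0
  · exfalso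
    refine hne ?_
    have h1 : ∀ u, l (0, S.D u, 0) = 0 := by
      intro u
      have h2 : t₁ * l (0, S.D u, 0) = 0 := by
        refine eq_zero_of_forall_mul_le
          (c := C + ζ * x₀.1 + l (0, x₀.2.1, 0) + l (0, (0 : V), 0) + t₁ * τ) fun s => ?_
        have h3 := hmain₁ 0 (mem_of_mem_nhds hW₀) u s
        rw [hζ0] at h3 ⊢
        linarith
      exact (mul_eq_zero.mp h2).resolve_left ht₁
    have h2 : ∀ v, l (0, v, 0) = 0 := fun v =>
      congrFun (hD.equalizer hαc continuous_const (funext h1)) v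
    have h3 : ∀ x, l x = x.2.2 * τ := fun x => by
      rw [continuousLinearMap_split, h2, ← hζ, hζ0]
      simp [hτ]
    have h4 : ∀ g : OscillatorGroup S, l.comp (OscillatorGroup.Ad g⁻¹) = l := by
      intro g
      refine ContinuousLinearMap.ext fun x => ?_
      rw [ContinuousLinearMap.comp_apply, h3, h3 x]
      rfl
    ext m
    simp only [coadjointOrbit, h4, Set.mem_range, Set.mem_singleton_iff]
    exact ⟨fun ⟨_, h⟩ => h.symm, fun h => ⟨1, h.symm⟩⟩
  -- The summand `1` replaces `l (0, h, 0)`, which is below `1` after shrinking `W₀`.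
  · set K := C + ζ * x₀.1 + l (0, x₀.2.1, 0) + 1 + t₁ * τ with hK
    have hW₁ : {h : V | l (0, h, 0) < 1} ∈ 𝓝 (0 : V) :=
      (isOpen_lt hαc continuous_const).mem_nhds (by simp [← Prod.zero_eq_mk])
    have h0W : (0 : V) ∈ W₀ ∩ {h : V | l (0, h, 0) < 1} :=
      mem_of_mem_nhds (inter_mem hW₀ hW₁)
    have hbd : ∀ h ∈ W₀ ∩ {h : V | l (0, h, 0) < 1}, ∀ u,
        (ζ * S.ω u (x₀.2.1 + h) - t₁ * l (0, S.D u, 0)) ^ 2 ≤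
          4 * (ζ * t₁ / 2 * S.ω (S.D u) u) * K := by
      intro h hh u
      refine sq_le_of_forall_quadratic_nonneg fun s => (hmain₁ h hh.1 u s).trans ?_
      have : l (0, h, 0) < 1 := hh.2
      linarith
    refine ⟨_, inter_mem hW₀ hW₁, |8 * (ζ * t₁) * K| / ζ ^ 2, by positivity,
      fun u hu => ?_⟩
    have h1 := hbd _ hu u
    have h2 := hbd 0 h0W u
    rw [add_zero] at h2
    have h3 : S.ω u (x₀.2.1 + S.D u) = S.ω u x₀.2.1 - S.ω (S.D u) u := by
      rw [map_add, S.ω_swap u (S.D u)]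
      ring
    rw [h3] at h1
    set q := S.ω (S.D u) u with hqd
    have hq0 : 0 ≤ q := hq u
    set f := ζ * S.ω u x₀.2.1 - t₁ * l (0, S.D u, 0) with hf
    have h4 : ζ * (S.ω u x₀.2.1 - q) - t₁ * l (0, S.D u, 0) = f - ζ * q := by
      rw [hf]; ring
    rw [h4] at h1
    -- The bounds for `h = Du` and `h = 0` are combined through `(ζq)² ≤ 2(f - ζq)² + 2f²`; dividing
    -- by `q > 0` gives the constant.
    have h5 : (ζ * q) ^ 2 ≤ 8 * (ζ * t₁) * K * q := by
      nlinarith [sq_nonneg (2 * f - ζ * q)]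
    have hζ2 : 0 < ζ ^ 2 := by positivity
    rcases hq0.eq_or_lt with h0 | h0
    · rw [← h0]
      positivity
    · rw [le_div_iff₀ hζ2]
      have h6 : q * (q * ζ ^ 2) ≤ q * |8 * (ζ * t₁) * K| := by
        nlinarith [mul_le_mul_of_nonneg_left (le_abs_self (8 * (ζ * t₁) * K)) hq0]
      exact le_of_mul_le_mul_left h6 h0

end SemiEquicontinuous

/-! ### The derived representation and its numerical form -/

section DerivedRepresentation

variable {V : Type u} [AddCommGroup V] [Module ℝ V] [TopologicalSpace V]
  [IsTopologicalAddGroup V] [ContinuousSMul ℝ V] [T2Space V] {S : OscillatorData V}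
  {H : Type v} [NormedAddCommGroup H] [InnerProductSpace ℂ H] [CompleteSpace H]
  (π : OscillatorGroup S →* unitary (H →L[ℂ] H))

theorem exists_differential_orbitMap (ξ : smoothVectors π) :
    ∃ df : (ℝ × V × ℝ) × (ℝ × V × ℝ) → H, Continuous df ∧
      (∀ x y, HasVelocity (fun s : ℝ => orbitMap π (ξ : H) (x + s • y)) (df (x, y))) ∧
      ∀ y, derivedRep π y ξ = df (0, y) := by
  obtain ⟨-, df, h1, h2⟩ := IsSmoothMap.isCn (f := orbitMap π (ξ : H)) ξ.2 1
  refine ⟨df, h2.continuous, h1, fun y => ?_⟩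
  have h3 := hasVelocity_iff_hasDerivAt.mp (h1 0 y)
  simp only [zero_add] at h3
  exact h3.deriv

/-- The derived representation on a smooth vector is a continuous linear function of the Lie
algebra element. -/
noncomputable def derivedRepCLM (ξ : smoothVectors π) : (ℝ × V × ℝ) →L[ℝ] H where
  toFun y := derivedRep π y ξ
  map_add' y z := by
    obtain ⟨df, h1, h2, h3⟩ := exists_differential_orbitMap π ξ
    have h4 := HasVelocity.along_add (δ := fun q => df (q, y)) (by fun_prop) (fun q => h2 q y)
      (h2 0 z)
    rw [h3, h3, h3]
    exact (h2 0 (y + z)).unique h4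
  map_smul' r y := by
    obtain ⟨df, h1, h2, h3⟩ := exists_differential_orbitMap π ξ
    have h4 := (h2 0 y).rescale r
    simp only [mul_smul] at h4
    rw [h3, h3]
    exact (h2 0 (r • y)).unique h4
  cont := by
    obtain ⟨df, h1, h2, h3⟩ := exists_differential_orbitMap π ξ
    have h4 : Continuous fun y => df (0, y) := by fun_prop
    exact h4.congr fun y => (h3 y).symm

theorem hasVelocity_rep_curve (ξ : smoothVectors π) {c : ℝ → OscillatorGroup S} (hc0 : c 0 = 1)
    {x : ℝ × V × ℝ} (hc : HasVelocity (fun s => (c s).toVec) x) :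
    HasVelocity (fun s => (π (c s) : H →L[ℂ] H) ξ) (derivedRepCLM π ξ x) := by
  obtain ⟨df, h1, h2, h3⟩ := exists_differential_orbitMap π ξ
  have h4 := HasVelocity.comp_curve h1 h2 hc
  rw [hc0] at h4
  have h5 : derivedRepCLM π ξ x = df (0, x) := h3 x
  rw [h5]
  exact h4

/-- The numerical form `x ↦ Re ⟨ξ, -i dπ(x) ξ⟩`. -/
noncomputable def numericalForm (ξ : smoothVectors π) : (ℝ × V × ℝ) →L[ℝ] ℝ where
  toFun y := (⟪(ξ : H), -Complex.I • derivedRepCLM π ξ y⟫_ℂ).re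
  map_add' y z := by rw [map_add, smul_add, inner_add_right, Complex.add_re]
  map_smul' r y := by
    rw [map_smul, smul_comm, RCLike.real_smul_eq_coe_smul (K := ℂ), inner_smul_right]
    simp
  cont := by fun_prop

theorem numericalForm_apply (ξ : smoothVectors π) (x : ℝ × V × ℝ) :
    numericalForm π ξ x = (⟪(ξ : H), -Complex.I • derivedRepCLM π ξ x⟫_ℂ).re := rfl

theorem isBoundedAboveBy_derivedRep_iff (x : ℝ × V × ℝ) (C : ℝ) :
    IsBoundedAboveBy (Complex.I • derivedRep π x) C ↔
      ∀ ξ : smoothVectors π, -numericalForm π ξ x ≤ C * ‖(ξ : H)‖ ^ 2 := by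
  have h : ∀ ξ : smoothVectors π,
      -numericalForm π ξ x = (⟪(ξ : H), Complex.I • derivedRepCLM π ξ x⟫_ℂ).re := fun ξ => by
    rw [numericalForm_apply, neg_smul, inner_neg_right, Complex.neg_re, neg_neg]
  simp only [h]
  rfl

/-- Both sides are the velocity at `0` of `π(g) π(s x) π(g)⁻¹ ξ`, with `s x` read in the global
chart; no one-parameter group for `x` is needed. -/
theorem derivedRep_Ad (g : OscillatorGroup S) (x : ℝ × V × ℝ) (ξ : smoothVectors π) :
    derivedRepCLM π ξ (OscillatorGroup.Ad g x) = (π g : H →L[ℂ] H)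
      (derivedRepCLM π ⟨(π g⁻¹ : H →L[ℂ] H) ξ, rep_mem_smoothVectors π g⁻¹ ξ.2⟩ x) := by
  have h0 : OscillatorGroup.ofVec S 0 = 1 := rfl
  have h1 := hasVelocity_rep_curve π ξ (c := fun s : ℝ => g * OscillatorGroup.ofVec S (s • x) * g⁻¹)
    (by simp [h0]) (OscillatorGroup.hasVelocity_conj g x)
  have hx : HasVelocity (fun s : ℝ => (OscillatorGroup.ofVec S (s • x)).toVec) x := by
    have h1 := HasVelocity.line (0 : ℝ × V × ℝ) x
    simp only [zero_add] at h1
    exact h1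
  have h2 := hasVelocity_rep_curve π ⟨(π g⁻¹ : H →L[ℂ] H) ξ, rep_mem_smoothVectors π g⁻¹ ξ.2⟩
    (c := fun s : ℝ => OscillatorGroup.ofVec S (s • x)) (by simp [h0]) hx
  have h3 := hasVelocity_iff_hasDerivAt.mpr (((π g : H →L[ℂ] H).restrictScalars ℝ).hasFDerivAt
    |>.comp_hasDerivAt 0 (hasVelocity_iff_hasDerivAt.mp h2))
  refine h1.unique ?_
  simp only [rep_mul_apply]
  exact h3

theorem numericalForm_Ad (g : OscillatorGroup S) (x : ℝ × V × ℝ) (ξ : smoothVectors π) :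
    numericalForm π ξ (OscillatorGroup.Ad g x) = numericalForm π
      ⟨(π g⁻¹ : H →L[ℂ] H) ξ, rep_mem_smoothVectors π g⁻¹ ξ.2⟩ x := by
  rw [numericalForm_apply, numericalForm_apply, derivedRep_Ad, inner_smul_right, inner_smul_right]
  congr 2
  conv_lhs => rw [← rep_inner π g⁻¹, ← rep_mul_apply, inv_mul_cancel, rep_one_apply]

variable {π}

theorem numericalForm_central
    (hCentral : ∀ (t : ℝ) (ξ : H),
      (π ⟨t, 0, 0⟩ : H →L[ℂ] H) ξ = Complex.exp (Complex.I * t) • ξ)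
    (ξ : smoothVectors π) : numericalForm π ξ (1, 0, 0) = ‖(ξ : H)‖ ^ 2 := by
  have h1 : derivedRepCLM π ξ (1, 0, 0) = Complex.I • (ξ : H) := by
    have h2 : HasDerivAt (fun s : ℝ => Complex.exp (Complex.I * s)) Complex.I 0 := by
      have h3 : HasDerivAt (fun s : ℝ => Complex.I * (s : ℂ)) (Complex.I * 1) 0 :=
        (Complex.ofRealCLM.hasDerivAt (x := (0 : ℝ))).const_mul Complex.I
      simpa using h3.cexp
    refine HasDerivAt.deriv ((h2.smul_const (ξ : H)).congr_of_eventuallyEq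
      (Eventually.of_forall fun s => ?_))
    simp [orbitMap, OscillatorGroup.ofVec, hCentral]
  rw [numericalForm_apply, h1, smul_smul, neg_mul, Complex.I_mul_I, neg_neg,
    one_smul, inner_self_eq_norm_sq_to_K]
  simp [← Complex.ofReal_pow]

/-- The lower bound of `-i dπ(0,0,1)`, transported by the adjoint action of `s u` for `u ∈ V`. -/
theorem quadratic_nonneg_of_lower_bound
    (hCentral : ∀ (t : ℝ) (ξ : H),
      (π ⟨t, 0, 0⟩ : H →L[ℂ] H) ξ = Complex.exp (Complex.I * t) • ξ)
    {c : ℝ} (hc : ∀ ξ : smoothVectors π, c * ‖(ξ : H)‖ ^ 2 ≤ numericalForm π ξ (0, 0, 1))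
    (ξ : smoothVectors π) (u : V) (s : ℝ) :
    0 ≤ (‖(ξ : H)‖ ^ 2 / 2 * S.ω (S.D u) u) * (s * s) + (-numericalForm π ξ (0, S.D u, 0)) * s +
      (numericalForm π ξ (0, 0, 1) - c * ‖(ξ : H)‖ ^ 2) := by
  -- For `g = (0,su,0)`, `Ad g (0,0,1) = ((s²/2) ω(Du,u), -s Du, 1)`.
  have h1 := hc ⟨_, rep_mem_smoothVectors π (⟨0, s • u, 0⟩ : OscillatorGroup S)⁻¹ ξ.2⟩
  rw [← numericalForm_Ad, rep_norm, OscillatorGroup.Ad_vec_apply, continuousLinearMap_split,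
    numericalForm_central hCentral] at h1
  have h2 : numericalForm π ξ (0, (0 : V) - (1 : ℝ) • s • S.D u, 0) =
      -(s * numericalForm π ξ (0, S.D u, 0)) := by
    rw [← smul_eq_mul, ← map_smul (numericalForm π ξ), ← map_neg (numericalForm π ξ)]
    simp
  simp only [map_smul, LinearMap.smul_apply, smul_eq_mul, map_zero] at h1
  rw [h2] at h1
  linarith

/-! ### Generators of one-parameter subgroups -/

section OneParameter

variable (π) {x : ℝ × V × ℝ} {c : ℝ → OscillatorGroup S}

theorem oneParam_zero (hadd : ∀ s t, c (s + t) = c s * c t) : c 0 = 1 := by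
  simpa using hadd 0 0

theorem hasDerivAt_rep_oneParam (hadd : ∀ s t, c (s + t) = c s * c t)
    (hc : HasVelocity (fun s : ℝ => (c s).toVec) x) (ξ : smoothVectors π) (s : ℝ) :
    HasDerivAt (fun s => (π (c s) : H →L[ℂ] H) ξ)
      (derivedRepCLM π ⟨(π (c s) : H →L[ℂ] H) ξ, rep_mem_smoothVectors π (c s) ξ.2⟩ x) s := by
  have h1 := hasVelocity_iff_hasDerivAt.mp (hasVelocity_rep_curve π
    ⟨(π (c s) : H →L[ℂ] H) ξ, rep_mem_smoothVectors π (c s) ξ.2⟩ (oneParam_zero hadd) hc)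
  rw [← sub_self s] at h1
  refine (h1.comp_sub_const s s).congr_of_eventuallyEq (Eventually.of_forall fun r => ?_)
  simp only [← rep_mul_apply, ← hadd, sub_add_cancel]

theorem derivedRep_skew (hadd : ∀ s t, c (s + t) = c s * c t)
    (hc : HasVelocity (fun s : ℝ => (c s).toVec) x) (ξ η : smoothVectors π) :
    ⟪(ξ : H), derivedRepCLM π η x⟫_ℂ + ⟪derivedRepCLM π ξ x, (η : H)⟫_ℂ = 0 := by
  have h0 := oneParam_zero hadd
  have h1 := hasVelocity_iff_hasDerivAt.mp (hasVelocity_rep_curve π ξ h0 hc)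
  have h2 := hasVelocity_iff_hasDerivAt.mp (hasVelocity_rep_curve π η h0 hc)
  have h3 := h1.inner ℂ h2
  simp only [rep_inner, h0, rep_one_apply] at h3
  exact h3.unique (hasDerivAt_const _ _)

/-- A densely defined symmetric operator is contained in its closed adjoint. -/
theorem isClosable_derivedRep (hSmooth : IsSmoothRep π) (hadd : ∀ s t, c (s + t) = c s * c t)
    (hc : HasVelocity (fun s : ℝ => (c s).toVec) x) :
    (Complex.I • derivedRep π x).IsClosable := by
  have hdense : Dense ((Complex.I • derivedRep π x).domain : Set H) := hSmooth
  have hformal : (Complex.I • derivedRep π x).IsFormalAdjoint (Complex.I • derivedRep π x) := by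
    intro ξ η
    have h1 := derivedRep_skew π hadd hc ξ η
    change ⟪Complex.I • derivedRepCLM π ξ x, (η : H)⟫_ℂ =
      ⟪(ξ : H), Complex.I • derivedRepCLM π η x⟫_ℂ
    rw [inner_smul_left, inner_smul_right, Complex.conj_I]
    linear_combination (-Complex.I) * h1
  exact (LinearPMap.adjoint_isClosed hdense).isClosable.leIsClosable (hformal.le_adjoint hdense)

/-- For `ψ` orthogonal to the range, the matrix coefficient `f(s) = ⟨ψ, π(c s)ξ⟩` solves `f' = -iμ
f`, because `π(c s)ξ` remains in the domain. So `|f(s)| = exp(s Im μ) |f(0)|`, and boundedness as `s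
→ ∞` forces `f(0) = 0`. -/
theorem shiftedRange_derivedRep_orthogonal (hSmooth : IsSmoothRep π)
    (hadd : ∀ s t, c (s + t) = c s * c t) (hc : HasVelocity (fun s : ℝ => (c s).toVec) x)
    {μ : ℂ} (hμ : 0 < μ.im) : (shiftedRange (Complex.I • derivedRep π x) μ)ᗮ = ⊥ := by
  rw [Submodule.eq_bot_iff]
  intro ψ hψ
  refine hSmooth.eq_zero_of_inner_left (𝕜 := ℂ) fun η hη => ?_
  obtain ⟨ξ, rfl⟩ : ∃ ξ : smoothVectors π, (ξ : H) = η := ⟨⟨η, hη⟩, rfl⟩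
  set f : ℝ → ℂ := fun s => ⟪ψ, (π (c s) : H →L[ℂ] H) ξ⟫_ℂ with hf
  have hder : ∀ s, HasDerivAt f (-Complex.I * μ * f s) s := by
    intro s
    set η : smoothVectors π := ⟨(π (c s) : H →L[ℂ] H) ξ, rep_mem_smoothVectors π (c s) ξ.2⟩ with hη
    have h1 : HasDerivAt f ⟪ψ, derivedRepCLM π η x⟫_ℂ s :=
      ((innerSL ℂ ψ).restrictScalars ℝ).hasFDerivAt.comp_hasDerivAt s
        (hasDerivAt_rep_oneParam π hadd hc ξ s)
    have h2 : ⟪ψ, Complex.I • derivedRepCLM π η x - μ • (η : H)⟫_ℂ = 0 :=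
      (Submodule.mem_orthogonal' _ _).mp hψ _ (mem_shiftedRange
        (A := Complex.I • derivedRep π x) (μ := μ) η)
    rw [inner_sub_right, inner_smul_right, inner_smul_right] at h2
    have h3 : -Complex.I * μ * f s = ⟪ψ, derivedRepCLM π η x⟫_ℂ := by
      change -Complex.I * μ * ⟪ψ, (η : H)⟫_ℂ = _
      linear_combination Complex.I * h2 - ⟪ψ, derivedRepCLM π η x⟫_ℂ * Complex.I_mul_I
    rw [h3]
    exact h1
  set g : ℝ → ℂ := fun s => Complex.exp (Complex.I * μ * s) * f s with hg
  have hgder : ∀ s, HasDerivAt g 0 s := by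
    intro s
    have h1 : HasDerivAt (fun s : ℝ => Complex.I * μ * (s : ℂ)) (Complex.I * μ * 1) s :=
      (Complex.ofRealCLM.hasDerivAt (x := s)).const_mul (Complex.I * μ)
    have h2 := h1.cexp.mul (hder s)
    have h3 : Complex.exp (Complex.I * μ * s) * (Complex.I * μ * 1) * f s +
        Complex.exp (Complex.I * μ * s) * (-Complex.I * μ * f s) = 0 := by ring
    rw [h3] at h2
    exact h2
  have hconst : ∀ s, f 0 = g s := by
    intro s
    have h1 := is_const_of_deriv_eq_zero (fun s => (hgder s).differentiableAt)
      (fun s => (hgder s).deriv) 0 s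
    rw [← h1, hg]
    simp
  have hle : ∀ s : ℝ, ‖f 0‖ ≤ Real.exp (-(μ.im * s)) * (‖ψ‖ * ‖(ξ : H)‖) := by
    intro s
    rw [hconst s, hg, norm_mul, Complex.norm_exp]
    have h1 : (Complex.I * μ * s).re = -(μ.im * s) := by simp
    rw [h1]
    gcongr
    refine (norm_inner_le_norm _ _).trans ?_
    rw [rep_norm]
  have hlim : Tendsto (fun s : ℝ => Real.exp (-(μ.im * s)) * (‖ψ‖ * ‖(ξ : H)‖)) atTop (𝓝 0) := by
    have h1 := (Real.tendsto_exp_neg_atTop_nhds_zero.comp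
      (tendsto_id.const_mul_atTop hμ)).mul_const (‖ψ‖ * ‖(ξ : H)‖)
    simpa using h1
  have h0 : f 0 = 0 := norm_le_zero_iff.mp (ge_of_tendsto' hlim hle)
  simpa [hf, oneParam_zero hadd] using h0

end OneParameter

end DerivedRepresentation

/-! ### Semiboundedness near `(0, 0, 1)` -/

theorem mainTheorem9 {V : Type u} [AddCommGroup V] [Module ℝ V] [TopologicalSpace V]
    [IsTopologicalAddGroup V] [ContinuousSMul ℝ V] [T2Space V] [LocallyConvexSpace ℝ V]
    (S : OscillatorData V)
    (hOrbit : ∃ l : (ℝ × V × ℝ) →L[ℝ] ℝ,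
      coadjointOrbit S l ≠ {l} ∧ IsSemiEquicontinuous (coadjointOrbit S l))
    (hD : DenseRange S.D)
    {H : Type v} [NormedAddCommGroup H] [InnerProductSpace ℂ H] [CompleteSpace H]
    (π : OscillatorGroup S →* unitary (H →L[ℂ] H))
    (hSmooth : IsSmoothRep π)
    (hCentral : ∀ (t : ℝ) (ξ : H),
      (π ⟨t, 0, 0⟩ : H →L[ℂ] H) ξ = Complex.exp (Complex.I * t) • ξ)
    (hBelow : IsBoundedBelow ((-Complex.I) • derivedRep π (0, 0, 1))) :
    IsSemibounded π := by
  suffices hnum : ∃ U ∈ 𝓝 ((0 : ℝ), (0 : V), (1 : ℝ)), ∃ C : ℝ, ∀ x ∈ U,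
      IsBoundedAboveBy (Complex.I • derivedRep π x) C by
    obtain ⟨U, hU, C, hC⟩ := hnum
    refine ⟨_, U, hU, C, fun x hx => ⟨hC x hx, ?_⟩⟩
    rintro ⟨c, hadd, hc⟩
    exact (hC x hx).supSpec_le (isClosable_derivedRep π hSmooth hadd hc)
      fun μ hμ => shiftedRange_derivedRep_orthogonal π hSmooth hadd hc hμ
  obtain ⟨c, hc⟩ := hBelow
  have hc : ∀ ξ : smoothVectors π, c * ‖(ξ : H)‖ ^ 2 ≤ numericalForm π ξ (0, 0, 1) := hc
  have hquad := quadratic_nonneg_of_lower_bound hCentral hc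
  -- A nonzero smooth vector is needed to read off the sign of `ω(Du,u)`; without one the numerical
  -- bounds are trivial.
  by_cases hex : ∃ ξ : smoothVectors π, (ξ : H) ≠ 0
  swap
  · refine ⟨Set.univ, univ_mem, 0, fun x _ => (isBoundedAboveBy_derivedRep_iff π x 0).mpr
      fun ξ => ?_⟩
    have h0 : (ξ : H) = 0 := by
      by_contra h
      exact hex ⟨ξ, h⟩
    simp [numericalForm_apply, h0]
  have hq : ∀ u, 0 ≤ S.ω (S.D u) u := by
    obtain ⟨ξ, hξ⟩ := hex
    intro u
    by_contra! hlt
    have hn : 0 < ‖(ξ : H)‖ ^ 2 := by positivity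
    have h2 := hc ξ
    have h3 := hquad ξ u
    set a := ‖(ξ : H)‖ ^ 2 / 2 * S.ω (S.D u) u with ha
    have ha0 : a < 0 := mul_neg_of_pos_of_neg (by positivity) hlt
    set B := numericalForm π ξ (0, 0, 1) - c * ‖(ξ : H)‖ ^ 2 with hB
    have hB0 : 0 ≤ B := by linarith
    -- Adding the inequalities at `s` and `-s` cancels the linear term; this `s` makes `a s² + B`
    -- negative when `a < 0`.
    have h4 := h3 (1 + B / -a)
    have h5 := h3 (-(1 + B / -a))
    have h6 : 0 ≤ B / -a := div_nonneg hB0 (by linarith)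
    have h7 : a * (B / -a) = -B := by
      rw [div_neg, mul_neg, mul_div_cancel₀ _ ha0.ne]
    nlinarith
  obtain ⟨W, hW, M, hM0, hM⟩ := exists_hamiltonian_bound S hOrbit hD hq
  have hV : ∀ (ξ : smoothVectors π), ∀ v ∈ interior W, numericalForm π ξ (0, v, 0) ^ 2 ≤
      2 * (M * ‖(ξ : H)‖ ^ 2) * (numericalForm π ξ (0, 0, 1) - c * ‖(ξ : H)‖ ^ 2) := by
    intro ξ v hv
    have hcl : IsClosed {v : V | numericalForm π ξ (0, v, 0) ^ 2 ≤
        2 * (M * ‖(ξ : H)‖ ^ 2) * (numericalForm π ξ (0, 0, 1) - c * ‖(ξ : H)‖ ^ 2)} :=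
      isClosed_le (by fun_prop) continuous_const
    -- Passing to the interior makes the range of `D` dense in the set, and the estimate is a closed
    -- condition on `v`.
    refine closure_minimal ?_ hcl (hD.open_subset_closure_inter isOpen_interior hv)
    rintro _ ⟨hw, u, rfl⟩
    have h1 := sq_le_of_forall_quadratic_nonneg (hquad ξ u)
    have h2 := hM u (interior_subset hw)
    have h3 := sub_nonneg.mpr (hc ξ)
    rw [neg_sq] at h1
    refine h1.trans ?_
    have h4 : 4 * (‖(ξ : H)‖ ^ 2 / 2 * S.ω (S.D u) u) = 2 * (S.ω (S.D u) u * ‖(ξ : H)‖ ^ 2) := by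
      ring
    rw [h4]
    gcongr
  -- In the constant, `1` comes from `z > -1`, `2|c|` from `0 < t < 2`, and `M` from the
  -- `V`-component, whose `B/2` is absorbed since `t > 1/2`.
  refine ⟨Set.Ioo (-1) 1 ×ˢ interior W ×ˢ Set.Ioo (1 / 2) 2,
    prod_mem_nhds (Ioo_mem_nhds (by norm_num) (by norm_num))
      (prod_mem_nhds (interior_mem_nhds.mpr hW) (Ioo_mem_nhds (by norm_num) (by norm_num))),
    1 + 2 * |c| + M, ?_⟩
  rintro ⟨z, v, t⟩ ⟨hz, hv, ht⟩
  refine (isBoundedAboveBy_derivedRep_iff π _ _).mpr fun ξ => ?_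
  rw [continuousLinearMap_split, numericalForm_central hCentral]
  have h1 := hV ξ v hv
  have h2 := sub_nonneg.mpr (hc ξ)
  simp only [Set.mem_Ioo] at hz ht
  set n := ‖(ξ : H)‖ ^ 2 with hn
  have hn0 : 0 ≤ n := by positivity
  set B := numericalForm π ξ (0, 0, 1) - c * n with hB
  have hB' : numericalForm π ξ (0, 0, 1) = B + c * n := by rw [hB]; ring
  rw [hB']
  -- Arithmetic–geometric mean: `2MnB ≤ (B/2 + Mn)²`.
  have h3 : |numericalForm π ξ (0, v, 0)| ≤ B / 2 + M * n := by
    refine abs_le_of_sq_le_sq ?_ (by positivity)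
    nlinarith [sq_nonneg (B / 2 - M * n)]
  have h4 := (abs_le.mp h3).1
  have h5 : -n ≤ z * n := by nlinarith [hz.1]
  have h6 : B / 2 ≤ t * B := by nlinarith [ht.1]
  have h7 : -(2 * |c| * n) ≤ t * (c * n) := by
    have h8 : t * |c * n| ≤ 2 * |c * n| := by gcongr; exact ht.2.le
    rw [abs_mul, abs_of_nonneg hn0] at h8
    have h9 := neg_abs_le (c * n)
    rw [abs_mul, abs_of_nonneg hn0] at h9
    nlinarith [ht.1]
  linarith
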